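/- Let $\Omega\subset\mathbb{R}$ be a bounded open set, $\mathcal{E}=L^2(\Omega)\times L^2(\Omega)$ and $\mathcal{X}=L^2(\Omega)\times L^2(\Omega)\times H^2_0(\Omega)$ (real-valued functions). Consider $$u_t=u_{xx}+wv+uw,\qquad v_t=v_{xx}+wv+u,\qquad 0=w_{xxxx}+w+u+v\qquad (t\ge 0,\ x\in\Omega),$$ with $u(0,\cdot)=u_0$, $v(0,\cdot)=v_0$, and with either the homogeneous Dirichlet conditions $u=v=0$ on $\partial\Omega$ or the homogeneous Neumann conditions $u_x=v_x=0$ on $\partial\Omega$. Let $\mathcal{A}(u,v)=(u_{xx},v_{xx})$ on $\mathcal{E}$, with domain consisting of the pairs $(u,v)$ in $H^2(\Omega)\times H^2(\Omega)$ with $u,v\in H^1_0(\Omega)$ (Dirichlet case), respectively $u_x,v_x\in H^1_0(\Omega)$ (Neumann case). For $0<\tau\le+\infty$, a solution on $[0,\tau)$ is a function $U=(u,v,w)\in C([0,\tau),\mathcal{X})$ such that, for every $t\in[0,\tau)$, $w_{xxxx}(t)+w(t)+u(t)+v(t)=0$ in the sense of distributions on $\Omega$ and, with $V=(u,v)$,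 $$V(t)=T(t)V_0+\int_0^t T(t-s)\,\bigl(w(s)v(s)+u(s)w(s),\ w(s)v(s)+u(s)\bigr)\,ds,$$ where $(T(t))_{t\ge0}$ is the $C_0$-semigroup of contractions on $\mathcal{E}$ generated by $\mathcal{A}$ (its existence is part of the claim). In both cases, for every $V_0=(u_0,v_0)\in\mathcal{E}$ there is $t_{\max}\in(0,+\infty]$ such that the problem has a unique solution $U\in C([0,t_{\max}),\mathcal{X})$; moreover $[0,t_{\max})$ is maximal: every solution on an interval $[0,\tau)$ satisfies $\tau\le t_{\max}$ and coincides with $U$ on $[0,\tau)$. -/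

import Mathlib

open MeasureTheory Topology Set Filter
open scoped Distributions ContDiff

namespace PDAE

noncomputable section

/-! ### Semigroups and generators on a Banach space -/

section Semigroup

variable {E : Type*} [NormedAddCommGroup E] [NormedSpace ℝ E]

/-- `T` restricted to `[0, ∞)` is a `C₀`-semigroup of contractions on `E`
(the values of `T` at negative times are irrelevant). -/
structure IsContractionSemigroup (T : ℝ → E →L[ℝ] E) : Prop where
  zero : T 0 = ContinuousLinearMap.id ℝ E
  add : ∀ s t : ℝ, 0 ≤ s → 0 ≤ t → T (s + t) = (T s).comp (T t)
  tendsto_zero : ∀ x : E, Tendsto (fun h : ℝ => T h x) (𝓝[>] 0) (𝓝 x)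
  norm_le : ∀ (t : ℝ) (x : E), 0 ≤ t → ‖T t x‖ ≤ ‖x‖

/-- The operator with graph `A` (`A x y` means: `x` lies in the domain and is mapped to `y`) is the
infinitesimal generator of `T`: the domain is the set of all `x` for which the limit of
`(T h x - x) / h` as `h → 0+` exists, and the operator maps `x` to this limit. -/
def IsGenerator (T : ℝ → E →L[ℝ] E) (A : E → E → Prop) : Prop :=
  ∀ x y : E, A x y ↔ Tendsto (fun h : ℝ => h⁻¹ • (T h x - x)) (𝓝[>] 0) (𝓝 y)

end Semigroup

/-! ### Function spaces on an open set of the line -/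

variable (Ω : TopologicalSpace.Opens ℝ)

/-- The real space `L²(Ω)`. -/
abbrev L2 : Type := Lp ℝ 2 (volume.restrict (Ω : Set ℝ))

/-- `𝓔 = L²(Ω) × L²(Ω)` with the norm `(‖u‖² + ‖v‖²)^(1/2)`. -/
abbrev StateE : Type := WithLp 2 (L2 Ω × L2 Ω)

variable {Ω}

/-- `g` is the weak (distributional) derivative of `u` on `Ω`. -/
def HasWeakDeriv (u g : L2 Ω) : Prop :=
  ∀ φ : 𝓓(Ω, ℝ), ∫ x in (Ω : Set ℝ), u x * deriv φ x = -∫ x in (Ω : Set ℝ), g x * φ x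

/-- `u ∈ H¹₀(Ω)`: the pair `(u, u')` is a limit in `L² × L²` of pairs `(φ, φ')` with `φ` a test
function. -/
def MemH10 (u : L2 Ω) : Prop :=
  ∃ g : L2 Ω, (u, g) ∈ closure {p : L2 Ω × L2 Ω | ∃ φ : 𝓓(Ω, ℝ),
    p.1 =ᵐ[volume.restrict (Ω : Set ℝ)] φ ∧ p.2 =ᵐ[volume.restrict (Ω : Set ℝ)] deriv φ}

variable (Ω)

/-- The space of jets `(φ, φ', φ'')` of test functions `φ` on `Ω`, in `L²(Ω)³`. -/
def testJets : Submodule ℝ (PiLp 2 (fun _ : Fin 3 => L2 Ω)) where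
  carrier := {p | ∃ φ : 𝓓(Ω, ℝ),
    ∀ k : Fin 3, p k =ᵐ[volume.restrict (Ω : Set ℝ)] iteratedDeriv k φ}
  zero_mem' := by
    refine ⟨0, fun k => ?_⟩
    have h : iteratedDeriv (k : ℕ) ((0 : 𝓓(Ω, ℝ)) : ℝ → ℝ) = 0 := by
      rw [FunLike.coe_zero]
      funext x
      simp
    rw [h]
    exact Lp.coeFn_zero _ _ _
  add_mem' := by
    rintro p q ⟨φ, hφ⟩ ⟨ψ, hψ⟩
    refine ⟨φ + ψ, fun k => ?_⟩
    have h : iteratedDeriv (k : ℕ) ((φ + ψ : 𝓓(Ω, ℝ)) : ℝ → ℝ)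
        = iteratedDeriv k φ + iteratedDeriv k ψ := by
      rw [FunLike.coe_add]
      funext x
      exact iteratedDeriv_add (φ.contDiff.contDiffAt.of_le (by exact_mod_cast le_top))
        (ψ.contDiff.contDiffAt.of_le (by exact_mod_cast le_top))
    rw [h]
    exact (Lp.coeFn_add _ _).trans ((hφ k).add (hψ k))
  smul_mem' := by
    rintro c p ⟨φ, hφ⟩
    refine ⟨c • φ, fun k => ?_⟩
    have h : iteratedDeriv (k : ℕ) ((c • φ : 𝓓(Ω, ℝ)) : ℝ → ℝ) = c • iteratedDeriv k φ := by
      rw [FunLike.coe_smul]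
      funext x
      exact iteratedDeriv_const_smul_field c φ
    rw [h]
    exact (Lp.coeFn_smul _ _).trans ((hφ k).const_smul c)

/-- `H²₀(Ω)`, the closure of the test functions in the `H²` norm
`(‖w‖² + ‖w'‖² + ‖w''‖²)^(1/2)`. An element `w` is represented by its jet `(w, w', w'')`; the first
entry determines the other two, which are its weak derivatives. For bounded `Ω` the norm is
equivalent to `‖w''‖`, by Poincaré's inequality. -/
abbrev H20 : Type := (testJets Ω).topologicalClosure

variable {Ω}

/-- The `L²` function underlying an element of `H²₀(Ω)`. -/
def H20.toL2 (w : H20 Ω) : L2 Ω := (w : PiLp 2 (fun _ : Fin 3 => L2 Ω)) 0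

variable (Ω)

/-- `𝓧 = L²(Ω) × L²(Ω) × H²₀(Ω)`, with the Hilbertian product norm. -/
abbrev StateX : Type := WithLp 2 (StateE Ω × H20 Ω)

variable {Ω}

/-! ### The system -/

/-- The boundary conditions imposed on `u` and `v`. -/
inductive BoundaryCondition : Type
  | dirichlet : BoundaryCondition
  | neumann : BoundaryCondition

/-- `u ∈ H²(Ω)` with `u_xx = f`, where `u` satisfies the homogeneous boundary condition `b`:
`u = 0` on `∂Ω`, i.e. `u ∈ H¹₀(Ω)`, in the Dirichlet case, and `u_x = 0` on `∂Ω`, i.e.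
`u_x ∈ H¹₀(Ω)`, in the Neumann case. -/
def HasSecondDeriv (b : BoundaryCondition) (u f : L2 Ω) : Prop :=
  ∃ u' : L2 Ω, HasWeakDeriv u u' ∧ HasWeakDeriv u' f ∧
    match b with
    | BoundaryCondition.dirichlet => MemH10 u
    | BoundaryCondition.neumann => MemH10 u'

/-- The graph of the operator `𝓐 (u, v) = (u_xx, v_xx)` in `𝓔`, with boundary condition `b`. -/
def opA (b : BoundaryCondition) (V Y : StateE Ω) : Prop :=
  HasSecondDeriv b V.fst Y.fst ∧ HasSecondDeriv b V.snd Y.snd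

/-- `f = 𝓕 (U)`, where `𝓕 (u, v, w) = (w v + u w, w v + u)`. -/
def IsReaction (U : StateX Ω) (f : StateE Ω) : Prop :=
  (f.fst =ᵐ[volume.restrict (Ω : Set ℝ)] fun x =>
    U.snd.toL2 x * U.fst.snd x + U.fst.fst x * U.snd.toL2 x) ∧
  (f.snd =ᵐ[volume.restrict (Ω : Set ℝ)] fun x =>
    U.snd.toL2 x * U.fst.snd x + U.fst.fst x)

/-- `0 = w_xxxx + w + u + v` on `Ω` in the sense of distributions. -/
def AlgebraicEq (U : StateX Ω) : Prop :=
  ∀ φ : 𝓓(Ω, ℝ), (∫ x in (Ω : Set ℝ), U.snd.toL2 x * iteratedDeriv 4 φ x)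
    + ∫ x in (Ω : Set ℝ), (U.snd.toL2 x + U.fst.fst x + U.fst.snd x) * φ x = 0

/-- The time interval `[0, τ)`, where `τ` may be `+∞`. -/
def timeInterval (τ : EReal) : Set ℝ := {t : ℝ | 0 ≤ t ∧ (t : EReal) < τ}

/-- `U = (V, w) ∈ C([0, τ), 𝓧)` is a mild solution of `V_t = 𝓐 V + 𝓕 (U)`, `V(0) = V₀`, coupled to
the algebraic equation at every time: with `T` the `C₀`-semigroup of contractions generated by `𝓐`,
`V(t) = T(t) V₀ + ∫₀ᵗ T(t - s) 𝓕(U(s)) ds` for all `t ∈ [0, τ)`. -/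
def IsSolution (b : BoundaryCondition) (V₀ : StateE Ω) (τ : EReal) (U : ℝ → StateX Ω) : Prop :=
  ContinuousOn U (timeInterval τ) ∧
  (∀ t ∈ timeInterval τ, AlgebraicEq (U t)) ∧
  ∃ (T : ℝ → StateE Ω →L[ℝ] StateE Ω) (f : ℝ → StateE Ω),
    IsContractionSemigroup T ∧ IsGenerator T (opA b) ∧
    (∀ t ∈ timeInterval τ, IsReaction (U t) (f t)) ∧
    ∀ t ∈ timeInterval τ,
      IntervalIntegrable (fun s => T (t - s) (f s)) volume 0 t ∧
      (U t).fst = T t V₀ + ∫ s in (0 : ℝ)..t, T (t - s) (f s)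

end

end PDAE

/-! For fixed `(u, v)` the fourth equation is linear elliptic in `w`, so it can be solved once and
for all, and the system becomes a semilinear evolution equation in `V = (u, v)` alone.

Elimination of `w`: the form `∫ w z + ∫ w'' z''` is coercive on `H²₀(Ω)`, so Lax–Milgram gives a
bounded operator `P` from `𝓔` to `H²₀(Ω)` such that the algebraic equation means `w = P V`
(`exists_algebraic_solution`). In one dimension `H²₀(Ω)` embeds in `L^∞` (`H20.ae_abs_le_norm`), so
products of `w` with `L²` functions are bounded bilinear, and the reaction, a quadratic polynomial
in `V`, is Lipschitz on bounded sets of `𝓔`.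

Semigroup: let `D` be the closure in `L²(Ω)` of differentiation on test functions. The weak
derivative is `-D*`, so the second derivative is `-D* D` for Dirichlet and `-D D*` for Neumann
conditions. Both are m-dissipative (`isMDissipative_opA`), and the Hille–Yosida theorem, proved by
Yosida approximation, yields the contraction semigroup.

Conclusion: Picard iteration gives local mild solutions, Grönwall gives uniqueness, and gluing all
of them gives the maximal one (`exists_isMild_maximal`). A generator determines its semigroup, so
the semigroup quantified inside `IsSolution` may be fixed in advance (`isSolution_iff`). -/

namespace PDAE

noncomputable section

/-! ### Contraction semigroups and uniqueness from the generator. -/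

section Semigroup

variable {E : Type*} [NormedAddCommGroup E] [NormedSpace ℝ E]

/-- The value at `x` of the infinitesimal generator of `T` exists and equals `y`. -/
def GeneratorAt (T : ℝ → E →L[ℝ] E) (x y : E) : Prop :=
  Tendsto (fun h : ℝ => h⁻¹ • (T h x - x)) (𝓝[>] 0) (𝓝 y)

theorem hasDerivWithinAt_Ici_iff_tendsto {f : ℝ → E} {y : E} {s : ℝ} :
    HasDerivWithinAt f y (Ici s) s ↔
      Tendsto (fun h : ℝ => h⁻¹ • (f (s + h) - f s)) (𝓝[>] 0) (𝓝 y) := by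
  rw [← hasDerivWithinAt_Ioi_iff_Ici, hasDerivWithinAt_iff_tendsto_slope' (by simp)]
  have h : 𝓝[>] s = map (fun h => s + h) (𝓝[>] 0) := by
    simp
  rw [h, tendsto_map'_iff]
  refine tendsto_congr fun t => ?_
  simp [slope]

namespace IsContractionSemigroup

variable {S T : ℝ → E →L[ℝ] E}

theorem norm_sub_le (hT : IsContractionSemigroup T) (x : E) {s t : ℝ} (hs : 0 ≤ s) (ht : 0 ≤ t) :
    ‖T t x - T s x‖ ≤ ‖T |t - s| x - x‖ := by
  wlog h : s ≤ t generalizing s t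
  · rw [norm_sub_rev, abs_sub_comm]
    exact this ht hs (le_of_not_ge h)
  rw [abs_of_nonneg (sub_nonneg.2 h)]
  have : T t x = T s (T (t - s) x) := by
    rw [← ContinuousLinearMap.comp_apply, ← hT.add _ _ hs (sub_nonneg.2 h), add_sub_cancel]
  rw [this, ← map_sub]
  exact hT.norm_le _ _ hs

theorem tendsto_abs (hT : IsContractionSemigroup T) (x : E) :
    Tendsto (fun h : ℝ => T |h| x) (𝓝 0) (𝓝 x) := by
  rw [Metric.tendsto_nhds_nhds]
  intro ε hε
  obtain ⟨δ, hδ, h⟩ := Metric.tendsto_nhdsWithin_nhds.1 (hT.tendsto_zero x) ε hε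
  refine ⟨δ, hδ, fun {t} ht => ?_⟩
  by_cases h0 : t = 0
  · simp [h0, hT.zero, hε]
  · exact h (abs_pos.2 h0) (by simpa using ht)

/-- A contraction semigroup, extended by `T 0` to negative times, is jointly continuous. -/
theorem continuous_max (hT : IsContractionSemigroup T) :
    Continuous (fun p : ℝ × E => T (max p.1 0) p.2) := by
  rw [continuous_iff_continuousAt]
  rintro ⟨s, x⟩
  rw [ContinuousAt, tendsto_iff_norm_sub_tendsto_zero]
  have h1 : Tendsto (fun p : ℝ × E => ‖p.2 - x‖ + ‖T |max p.1 0 - max s 0| x - x‖) (𝓝 (s, x))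
      (𝓝 (‖x - x‖ + ‖x - x‖)) := by
    refine Tendsto.add ?_ ?_
    · exact ((continuous_snd.sub continuous_const).norm).tendsto (s, x)
    · refine (Tendsto.sub_const ((hT.tendsto_abs x).comp ?_) x).norm
      have : Continuous fun p : ℝ × E => max p.1 0 - max s 0 := by fun_prop
      simpa using this.tendsto (s, x)
  simp only [sub_self, norm_zero, add_zero] at h1
  refine squeeze_zero (fun _ => norm_nonneg _) (fun p => ?_) h1
  calc ‖T (max p.1 0) p.2 - T (max s 0) x‖
      = ‖T (max p.1 0) (p.2 - x) + (T (max p.1 0) x - T (max s 0) x)‖ := by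
        rw [map_sub]; congr 1; abel
    _ ≤ _ := (norm_add_le _ _).trans (add_le_add (hT.norm_le _ _ (le_max_right _ _))
        (hT.norm_sub_le x (le_max_right _ _) (le_max_right _ _)))

theorem continuousOn_apply (hT : IsContractionSemigroup T) {X : Type*} [TopologicalSpace X]
    {s : Set X} {a : X → ℝ} {g : X → E} (ha : ContinuousOn a s) (hg : ContinuousOn g s)
    (h0 : ∀ x ∈ s, 0 ≤ a x) : ContinuousOn (fun x => T (a x) (g x)) s := by
  have := hT.continuous_max.comp_continuousOn (ha.prodMk hg)
  refine this.congr fun x hx => ?_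
  simp [max_eq_left (h0 x hx)]

theorem generatorAt_apply (hT : IsContractionSemigroup T) {x y : E} (h : GeneratorAt T x y)
    {s : ℝ} (hs : 0 ≤ s) : GeneratorAt T (T s x) (T s y) := by
  refine (((T s).continuous.tendsto y).comp h).congr' ?_
  filter_upwards [self_mem_nhdsWithin] with t ht
  have : T t (T s x) = T s (T t x) := by
    rw [← ContinuousLinearMap.comp_apply, ← ContinuousLinearMap.comp_apply,
      ← hT.add _ _ hs (le_of_lt ht), ← hT.add _ _ (le_of_lt ht) hs, add_comm]
  simp [this]

/-- Two contraction semigroups are close if their generators are close along an orbit. -/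
theorem norm_sub_le_of_generatorAt (hS : IsContractionSemigroup S) (hT : IsContractionSemigroup T)
    {x : E} {C t : ℝ} (ht : 0 ≤ t)
    (h : ∀ s, 0 ≤ s → ∃ a b, GeneratorAt S (S s x) a ∧ GeneratorAt T (S s x) b ∧ ‖a - b‖ ≤ C) :
    ‖S t x - T t x‖ ≤ C * t := by
  choose! a b ha hb hab using h
  -- The path `s ↦ T (t - s) (S s x)` joins `T t x` to `S t x`, and its right derivative `T (t - s)
  -- (a s - b s)` has norm at most `C`.
  have key := norm_image_sub_le_of_norm_deriv_right_le_segment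
    (f := fun s => T (t - s) (S s x)) (f' := fun s => T (t - s) (a s - b s)) (a := 0) (b := t)
    (C := C) ?_ ?_ ?_ t ⟨ht, le_rfl⟩
  · simpa [hT.zero, hS.zero] using key
  · refine hT.continuousOn_apply (by fun_prop)
      (hS.continuousOn_apply continuousOn_id continuousOn_const fun s hs => hs.1)
      fun s hs => sub_nonneg.2 hs.2
  · rintro s ⟨hs, hst⟩
    rw [hasDerivWithinAt_Ici_iff_tendsto]
    -- By the semigroup law the increment of the path over `[s, s + h]` is `T (t - s - h)` applied
    -- to `S h (S s x) - T h (S s x)`. Time and argument both vary with `h`, hence the use of joint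
    -- continuity.
    have h1 : Tendsto (fun h : ℝ => (t - s - h, h⁻¹ • (S h (S s x) - S s x)
        - h⁻¹ • (T h (S s x) - S s x))) (𝓝[>] 0) (𝓝 (t - s, a s - b s)) := by
      refine Tendsto.prodMk_nhds ?_ ((ha s hs).sub (hb s hs))
      have : Continuous fun h : ℝ => t - s - h := by fun_prop
      simpa using (this.tendsto 0).mono_left nhdsWithin_le_nhds
    have h2 := (hT.continuous_max.tendsto _).comp h1
    simp only [max_eq_left (sub_nonneg.2 hst.le)] at h2
    refine h2.congr' ?_
    filter_upwards [Ioo_mem_nhdsGT (sub_pos.2 hst)] with r hr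
    have e1 : S (s + r) x = S r (S s x) := by rw [add_comm, hS.add _ _ hr.1.le hs]; rfl
    have e2 : T (t - s) (S s x) = T (t - s - r) (T r (S s x)) := by
      have := hT.add (t - s - r) r (sub_nonneg.2 hr.2.le) hr.1.le
      rw [sub_add_cancel] at this
      rw [this]; rfl
    simp only [Function.comp_apply, max_eq_left (sub_nonneg.2 hr.2.le)]
    rw [← smul_sub, map_smul, e1, e2, ← sub_sub, ← map_sub]
    congr 2
    abel
  · rintro s ⟨hs, hst⟩
    exact (hT.norm_le _ _ (sub_nonneg.2 hst.le)).trans (hab s hs)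

end IsContractionSemigroup

/-- The generator has dense domain. -/
def DenseDomain (A : E → E → Prop) : Prop := Dense {x | ∃ y, A x y}

/-- A generator with dense domain determines its contraction semigroup. -/
theorem IsContractionSemigroup.eq_of_isGenerator {S T : ℝ → E →L[ℝ] E} {A : E → E → Prop}
    (hS : IsContractionSemigroup S) (hT : IsContractionSemigroup T) (hSA : IsGenerator S A)
    (hTA : IsGenerator T A) (hA : DenseDomain A) {t : ℝ} (ht : 0 ≤ t) : S t = T t := by
  have : (S t : E → E) = T t := by
    refine Continuous.ext_on hA (S t).continuous (T t).continuous ?_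
    rintro x ⟨y, hxy⟩
    have h := hS.norm_sub_le_of_generatorAt hT (x := x) (C := 0) ht fun s hs => by
      have h := hS.generatorAt_apply ((hSA x y).1 hxy) hs
      exact ⟨_, _, h, (hTA _ _).1 ((hSA _ _).2 h), by simp⟩
    rw [zero_mul] at h
    exact sub_eq_zero.1 (norm_le_zero_iff.1 h)
  exact DFunLike.coe_injective this

end Semigroup

/-! ### The Hille–Yosida theorem for m-dissipative operators on a Hilbert space. -/

section HilleYosida

variable {E : Type*} [NormedAddCommGroup E] [InnerProductSpace ℝ E]

/-- A single-valued m-dissipative linear operator, given by its graph. -/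
structure IsMDissipative (A : E → E → Prop) : Prop where
  add : ∀ {x y x' y'}, A x y → A x' y' → A (x + x') (y + y')
  smul : ∀ (c : ℝ) {x y}, A x y → A (c • x) (c • y)
  unique : ∀ {x y y'}, A x y → A x y' → y = y'
  dissipative : ∀ {x y}, A x y → inner ℝ x y ≤ 0
  surjective : ∀ (l : ℝ), 0 < l → ∀ f, ∃ x y, A x y ∧ l • x - y = f

namespace IsMDissipative

variable {A : E → E → Prop}

theorem sub (hA : IsMDissipative A) {x y x' y' : E} (h : A x y) (h' : A x' y') :
    A (x - x') (y - y') := by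
  simpa [sub_eq_add_neg] using hA.add h (hA.smul (-1) h')

theorem norm_le (hA : IsMDissipative A) {l : ℝ} (hl : 0 < l) {x y : E} (h : A x y) :
    ‖x‖ ≤ l⁻¹ * ‖l • x - y‖ := by
  have h1 := hA.dissipative h
  have h2 : l * ‖x‖ ^ 2 ≤ inner ℝ x (l • x - y) := by
    rw [inner_sub_right, inner_smul_right, real_inner_self_eq_norm_sq]; linarith
  have h3 := h2.trans (real_inner_le_norm _ _)
  rw [inv_mul_eq_div, le_div_iff₀ hl]
  rcases (norm_nonneg x).eq_or_lt with h0 | h0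
  · rw [← h0]; simp
  · exact le_of_mul_le_mul_left (by linarith) h0

theorem eq_of_sub_eq (hA : IsMDissipative A) {l : ℝ} (hl : 0 < l) {x y x' y' : E} (h : A x y)
    (h' : A x' y') (he : l • x - y = l • x' - y') : x = x' := by
  have h1 := hA.norm_le hl (hA.sub h h')
  have : l • (x - x') - (y - y') = 0 := by
    rw [smul_sub, sub_sub_sub_comm, he, sub_self]
  rw [this, norm_zero, mul_zero] at h1
  exact sub_eq_zero.1 (norm_le_zero_iff.1 h1)

theorem exists_resolvent (hA : IsMDissipative A) {l : ℝ} (hl : 0 < l) :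
    ∃ R : E →L[ℝ] E, (∀ f, A (R f) (l • R f - f)) ∧ ∀ f, ‖R f‖ ≤ l⁻¹ * ‖f‖ := by
  choose R Y hR hY using hA.surjective l hl
  have hY' : ∀ f, Y f = l • R f - f := fun f => by
    have := hY f
    rw [sub_eq_iff_eq_add] at this
    rw [this, add_sub_cancel_left]
  let L : E →ₗ[ℝ] E :=
    { toFun := R
      map_add' := fun f g => hA.eq_of_sub_eq hl (hR _) (hA.add (hR f) (hR g)) (by
        rw [hY, smul_add, add_sub_add_comm, hY, hY])
      map_smul' := fun c f => hA.eq_of_sub_eq hl (hR _) (hA.smul c (hR f)) (by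
        rw [hY, RingHom.id_apply, smul_comm, ← smul_sub, hY]) }
  have hb : ∀ f, ‖L f‖ ≤ l⁻¹ * ‖f‖ := fun f => by
    have := hA.norm_le hl (hR f)
    rwa [hY] at this
  exact ⟨L.mkContinuous _ hb, fun f => hY' f ▸ hR f, hb⟩

/-- If `z` is orthogonal to the domain, solve `x - A x = z`. Pairing with `x` gives `‖x‖² = ⟨x, A x⟩
≤ 0`, so `x = 0` and then `z = 0`. -/
theorem denseDomain [CompleteSpace E] (hA : IsMDissipative A) : DenseDomain A := by
  have h0 : A 0 0 := by
    obtain ⟨x, y, h, -⟩ := hA.surjective 1 one_pos 0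
    simpa using hA.smul 0 h
  let K : Submodule ℝ E :=
    { carrier := {x | ∃ y, A x y}
      add_mem' := fun ⟨_, h⟩ ⟨_, h'⟩ => ⟨_, hA.add h h'⟩
      zero_mem' := ⟨0, h0⟩
      smul_mem' := fun c _ ⟨_, h⟩ => ⟨_, hA.smul c h⟩ }
  suffices Dense (K : Set E) from this
  rw [Submodule.dense_iff_topologicalClosure_eq_top, Submodule.topologicalClosure_eq_top_iff,
    Submodule.eq_bot_iff]
  intro z hz
  obtain ⟨x, y, h, he⟩ := hA.surjective 1 one_pos z
  have h1 : inner ℝ x z = 0 := hz x ⟨y, h⟩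
  rw [← he, inner_sub_right, one_smul, real_inner_self_eq_norm_sq] at h1
  have h2 := hA.dissipative h
  have hx : x = 0 := by
    rw [← norm_eq_zero]
    exact pow_eq_zero_iff two_ne_zero |>.1 (le_antisymm (by linarith) (sq_nonneg _))
  subst hx
  rw [← he, hA.unique h h0]; simp

end IsMDissipative

theorem cauchySeq_of_dense {L : ℕ → E →L[ℝ] E} (hL : ∀ n x, ‖L n x‖ ≤ ‖x‖) {D : Set E}
    (hD : Dense D) (h : ∀ x ∈ D, CauchySeq fun n => L n x) (x : E) :
    CauchySeq fun n => L n x := by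
  rw [Metric.cauchySeq_iff]
  intro ε hε
  obtain ⟨z, hz, hxz⟩ := hD.exists_dist_lt x (show 0 < ε / 3 by positivity)
  obtain ⟨N, hN⟩ := Metric.cauchySeq_iff.1 (h z hz) (ε / 3) (by positivity)
  have hd : ∀ n, dist (L n x) (L n z) < ε / 3 := fun n => by
    rw [dist_eq_norm, ← map_sub]
    exact (hL _ _).trans_lt (by rwa [← dist_eq_norm])
  refine ⟨N, fun m hm n hn => ?_⟩
  have h1 := dist_triangle4 (L m x) (L m z) (L n z) (L n x)
  have h2 := hd n
  rw [dist_comm] at h2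
  linarith [hd m, hN m hm n hn]

theorem tendsto_of_dense {L : ℕ → E →L[ℝ] E} (hL : ∀ n x, ‖L n x‖ ≤ ‖x‖) {D : Set E}
    (hD : Dense D) (h : ∀ x ∈ D, Tendsto (fun n => L n x) atTop (𝓝 x)) (x : E) :
    Tendsto (fun n => L n x) atTop (𝓝 x) := by
  rw [Metric.tendsto_atTop]
  intro ε hε
  obtain ⟨z, hz, hxz⟩ := hD.exists_dist_lt x (show 0 < ε / 3 by positivity)
  obtain ⟨N, hN⟩ := Metric.tendsto_atTop.1 (h z hz) (ε / 3) (by positivity)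
  refine ⟨N, fun n hn => ?_⟩
  have h1 := dist_triangle4 (L n x) (L n z) z x
  have h2 : dist (L n x) (L n z) < ε / 3 := by
    rw [dist_eq_norm, ← map_sub]
    exact (hL _ _).trans_lt (by rwa [← dist_eq_norm])
  rw [dist_comm] at hxz
  linarith [hN n hn]

variable [CompleteSpace E]

theorem hasDerivAt_exp_smul_apply (B : E →L[ℝ] E) (x : E) (t : ℝ) :
    HasDerivAt (fun u : ℝ => NormedSpace.exp (u • B) x) (B (NormedSpace.exp (t • B) x)) t := by
  have := (hasDerivAt_exp_smul_const' (𝕂 := ℝ) B t).clm_apply (hasDerivAt_const t x)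
  simpa using this

theorem generatorAt_exp (B : E →L[ℝ] E) (x : E) :
    GeneratorAt (fun t : ℝ => NormedSpace.exp (t • B)) x (B x) := by
  have h := (hasDerivAt_exp_smul_apply B x 0).hasDerivWithinAt (s := Ici 0)
  rw [hasDerivWithinAt_Ici_iff_tendsto] at h
  simpa [GeneratorAt] using h

/-- The derivative of `‖exp (t B) x‖²` is `2 ⟨exp (t B) x, B exp (t B) x⟩ ≤ 0`. -/
theorem isContractionSemigroup_exp {B : E →L[ℝ] E} (hB : ∀ x, inner ℝ (B x) x ≤ 0) :
    IsContractionSemigroup (fun t : ℝ => NormedSpace.exp (t • B)) where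
  zero := by simp; rfl
  add s t _ _ := by
    let _ : NormedAlgebra ℚ (E →L[ℝ] E) := NormedAlgebra.restrictScalars ℚ ℝ _
    rw [add_smul]
    exact NormedSpace.exp_add_of_commute ((Commute.refl B).smul_left s |>.smul_right t)
  tendsto_zero x := by
    have h := (hasDerivAt_exp_smul_apply B x 0).continuousAt.tendsto
    simp only [zero_smul, NormedSpace.exp_zero, one_apply_eq_self] at h
    exact h.mono_left nhdsWithin_le_nhds
  norm_le t x ht := by
    have h1 : ∀ t, HasDerivAt (fun u : ℝ => ‖NormedSpace.exp (u • B) x‖ ^ 2)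
        (2 * inner ℝ (NormedSpace.exp (t • B) x) (B (NormedSpace.exp (t • B) x))) t :=
      fun t => (hasDerivAt_exp_smul_apply B x t).norm_sq
    have h2 := antitone_of_deriv_nonpos (fun t => (h1 t).differentiableAt) (fun t => by
      rw [(h1 t).deriv, real_inner_comm]
      linarith [hB (NormedSpace.exp (t • B) x)]) ht
    simp only [zero_smul, NormedSpace.exp_zero, one_apply_eq_self] at h2
    exact (pow_le_pow_iff_left₀ (norm_nonneg _) (norm_nonneg _) two_ne_zero).1 h2

namespace IsMDissipative

variable {A : E → E → Prop}

/-- Bounded dissipative commuting operators approximating `A` on its domain. -/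
theorem exists_yosida (hA : IsMDissipative A) :
    ∃ B : ℕ → E →L[ℝ] E, (∀ n x, inner ℝ (B n x) x ≤ 0) ∧ (∀ m n, Commute (B m) (B n)) ∧
      ∀ x y, A x y → Tendsto (fun n => B n x) atTop (𝓝 y) := by
  have hl : ∀ n : ℕ, (0 : ℝ) < n + 1 := fun n => by positivity
  choose R hR hRb using fun n : ℕ => hA.exists_resolvent (hl n)
  have huniq : ∀ n {x y}, A x y → R n (((n : ℝ) + 1) • x - y) = x := fun n x y h =>
    hA.eq_of_sub_eq (hl n) (hR n _) h (by simp)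
  -- The resolvent commutes with `A`; by injectivity of `l - A`, the resolvents then commute with
  -- each other.
  have hcomm : ∀ n {x y}, A x y → A (R n x) (R n y) := fun n x y h => by
    have h1 := huniq n h
    rw [map_sub, map_smul, sub_eq_iff_eq_add', ← sub_eq_iff_eq_add] at h1
    exact h1 ▸ hR n x
  have hRR : ∀ m n, Commute (R m) (R n) := fun m n => by
    ext f
    have h := hcomm m (hR n f)
    rw [map_sub, map_smul] at h
    exact hA.eq_of_sub_eq (hl n) h (hR n (R m f)) (by simp)
  -- Yosida approximation: with `l = n + 1` this operator is `l A R`, since `A R = l R - 1`; on the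
  -- domain of `A` it equals `l R A`.
  refine ⟨fun n => ((n : ℝ) + 1) • (((n : ℝ) + 1) • R n - 1), fun n x => ?_, fun m n => ?_,
    fun x y hxy => ?_⟩
  · have h1 := hA.dissipative (hR n x)
    set Y := ((n : ℝ) + 1) • R n x - x with hY
    have h2 : x = ((n : ℝ) + 1) • R n x - Y := by rw [hY]; abel
    -- With `Y = A R x` one has `⟨Y, x⟩ = l ⟨R x, A R x⟩ - ‖Y‖²`.
    have h3 : inner ℝ Y x ≤ 0 := by
      rw [h2, inner_sub_right, inner_smul_right, real_inner_self_eq_norm_sq, real_inner_comm]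
      nlinarith [hl n, sq_nonneg ‖Y‖, mul_nonneg (hl n).le (neg_nonneg.2 h1)]
    have h4 : (((n : ℝ) + 1) • (((n : ℝ) + 1) • R n - 1)) x = ((n : ℝ) + 1) • Y := by simp [hY]
    rw [h4, real_inner_smul_left]
    exact mul_nonpos_of_nonneg_of_nonpos (hl n).le h3
  · refine Commute.smul_left (Commute.smul_right ?_ _) _
    refine Commute.sub_left (Commute.sub_right ?_ (Commute.one_right _)) (Commute.one_left _)
    exact Commute.smul_left (Commute.smul_right (hRR m n) _) _
  · have key : ∀ z, Tendsto (fun n : ℕ => (((n : ℝ) + 1) • R n) z) atTop (𝓝 z) := by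
      refine tendsto_of_dense (fun n z => ?_) hA.denseDomain ?_
      · have := hRb n z
        rw [smul_apply, norm_smul, Real.norm_of_nonneg (hl n).le]
        calc _ ≤ ((n : ℝ) + 1) * (((n : ℝ) + 1)⁻¹ * ‖z‖) := by gcongr
          _ = ‖z‖ := by rw [mul_inv_cancel_left₀ (hl n).ne']
      · rintro z ⟨w, hzw⟩
        rw [tendsto_iff_norm_sub_tendsto_zero]
        have h0 : Tendsto (fun n : ℕ => ((n : ℝ) + 1)⁻¹ * ‖w‖) atTop (𝓝 0) := by
          simpa using (tendsto_one_div_add_atTop_nhds_zero_nat (𝕜 := ℝ)).mul_const ‖w‖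
        refine squeeze_zero (fun _ => norm_nonneg _) (fun n => ?_) h0
        have h1 := huniq n hzw
        rw [map_sub, map_smul, sub_eq_iff_eq_add', ← sub_eq_iff_eq_add] at h1
        rw [smul_apply, h1]
        exact hRb n w
    refine (key y).congr fun n => ?_
    have h1 := huniq n hxy
    rw [map_sub, map_smul, sub_eq_iff_eq_add', ← sub_eq_iff_eq_add] at h1
    simp [h1]

/-- The Hille–Yosida theorem in a real Hilbert space. -/
theorem exists_semigroup (hA : IsMDissipative A) :
    ∃ T : ℝ → E →L[ℝ] E, IsContractionSemigroup T ∧ IsGenerator T A := by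
  obtain ⟨B, hB, hcomm, hlim⟩ := hA.exists_yosida
  set S : ℕ → ℝ → E →L[ℝ] E := fun n t => NormedSpace.exp (t • B n) with hS
  have hSc : ∀ n, IsContractionSemigroup (S n) := fun n => isContractionSemigroup_exp (hB n)
  have hSS : ∀ m n x t, 0 ≤ t → ‖S m t x - S n t x‖ ≤ ‖B m x - B n x‖ * t := by
    intro m n x t ht
    refine (hSc m).norm_sub_le_of_generatorAt (hSc n) ht fun s hs => ?_
    refine ⟨_, _, (hSc m).generatorAt_apply (generatorAt_exp _ _) hs, generatorAt_exp _ _, ?_⟩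
    have h1 : Commute (B n) (S m s) := by
      let _ : NormedAlgebra ℚ (E →L[ℝ] E) := NormedAlgebra.restrictScalars ℚ ℝ _
      exact ((hcomm n m).smul_right s).exp_right
    have h2 : B n (S m s x) = S m s (B n x) := congrArg (fun L : E →L[ℝ] E => L x) h1.eq
    rw [h2, ← map_sub]
    exact (hSc m).norm_le _ _ hs
  have hcau : ∀ t, 0 ≤ t → ∀ x, CauchySeq fun n => S n t x := by
    intro t ht
    refine cauchySeq_of_dense (fun n x => (hSc n).norm_le t x ht) hA.denseDomain ?_
    rintro x ⟨y, hxy⟩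
    rw [Metric.cauchySeq_iff]
    intro ε hε
    obtain ⟨N, hN⟩ := Metric.cauchySeq_iff.1 (hlim x y hxy).cauchySeq (ε / (t + 1)) (by positivity)
    refine ⟨N, fun m hm n hn => ?_⟩
    have h1 := hN m hm n hn
    rw [dist_eq_norm, lt_div_iff₀ (by positivity)] at h1
    rw [dist_eq_norm]
    linarith [hSS m n x t ht, norm_nonneg (B m x - B n x)]
  have hex : ∀ t, 0 ≤ t → ∃ L : E →L[ℝ] E, ∀ x, Tendsto (fun n => S n t x) atTop (𝓝 (L x)) := by
    intro t ht
    choose f hf using fun x => cauchySeq_tendsto_of_complete (hcau t ht x)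
    exact ⟨continuousLinearMapOfTendsto (S · t) (tendsto_pi_nhds.2 hf), hf⟩
  choose! T hT using hex
  have hTn : ∀ t x, 0 ≤ t → ‖T t x‖ ≤ ‖x‖ := fun t x ht =>
    le_of_tendsto (hT t ht x).norm (Eventually.of_forall fun n => (hSc n).norm_le t x ht)
  -- The bound is linear in `t`, so after division by `t` the difference quotients of `T` and `S n`
  -- are uniformly close. This is what identifies the generator.
  have hTS : ∀ n x y t, A x y → 0 ≤ t → ‖T t x - S n t x‖ ≤ ‖y - B n x‖ * t := by
    intro n x y t hxy ht
    exact le_of_tendsto_of_tendsto (((hT t ht x).sub_const _).norm)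
      (((hlim x y hxy).sub_const _).norm.mul_const t)
      (Eventually.of_forall fun m => hSS m n x t ht)
  have hgen : ∀ x y, A x y → GeneratorAt T x y := by
    intro x y hxy
    rw [GeneratorAt, Metric.tendsto_nhds]
    intro ε hε
    obtain ⟨n, hn⟩ := (Metric.tendsto_nhds.1 (hlim x y hxy) (ε / 3) (by positivity)).exists
    filter_upwards [Metric.tendsto_nhds.1 (generatorAt_exp (B n) x) (ε / 3) (by positivity),
      self_mem_nhdsWithin] with h hh (h0 : 0 < h)
    have h1 : dist (h⁻¹ • (T h x - x)) (h⁻¹ • (S n h x - x)) < ε / 3 := by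
      rw [dist_eq_norm, ← smul_sub, sub_sub_sub_cancel_right, norm_smul, Real.norm_of_nonneg
        (inv_nonneg.2 h0.le), inv_mul_lt_iff₀ h0]
      refine (hTS n x y h hxy h0.le).trans_lt ?_
      rw [mul_comm]
      gcongr
      rwa [← dist_eq_norm, dist_comm]
    have h2 := dist_triangle4 (h⁻¹ • (T h x - x)) (h⁻¹ • (S n h x - x)) (B n x) y
    simp only [hS] at h1 h2
    linarith
  have hTc : IsContractionSemigroup T :=
    { zero := by
        ext x
        refine tendsto_nhds_unique (hT 0 le_rfl x) ?_
        simp only [(hSc _).zero]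
        exact tendsto_const_nhds
      add := by
        intro s t hs ht
        ext x
        refine tendsto_nhds_unique (hT _ (add_nonneg hs ht) x) ?_
        have h1 : Tendsto (fun n => S n s (S n t x - T t x) + S n s (T t x)) atTop
            (𝓝 (0 + T s (T t x))) := by
          refine Tendsto.add ?_ (hT s hs _)
          have := tendsto_iff_norm_sub_tendsto_zero.1 (hT t ht x)
          exact squeeze_zero_norm (fun n => (hSc n).norm_le s _ hs) this
        rw [zero_add] at h1
        refine h1.congr fun n => ?_
        rw [← map_add, sub_add_cancel, (hSc n).add s t hs ht]; rfl
      tendsto_zero := by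
        intro x
        rw [Metric.tendsto_nhds]
        intro ε hε
        obtain ⟨z, ⟨y, hz⟩, hxz⟩ := hA.denseDomain.exists_dist_lt x (show 0 < ε / 3 by positivity)
        have h1 : Tendsto (fun h : ℝ => h • h⁻¹ • (T h z - z) + z) (𝓝[>] 0) (𝓝 z) := by
          have := ((tendsto_id.mono_left nhdsWithin_le_nhds).smul (hgen z y hz)).add_const z
          simpa using this
        filter_upwards [Metric.tendsto_nhds.1 h1 (ε / 3) (by positivity), self_mem_nhdsWithin]
          with h hh (h0 : 0 < h)
        rw [smul_inv_smul₀ h0.ne', sub_add_cancel] at hh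
        have h2 := dist_triangle4 (T h x) (T h z) z x
        have h3 : dist (T h x) (T h z) < ε / 3 := by
          rw [dist_eq_norm, ← map_sub]
          exact (hTn h _ h0.le).trans_lt (by rwa [← dist_eq_norm])
        rw [dist_comm] at hxz
        linarith
      norm_le := hTn }
  refine ⟨T, hTc, fun x y => ⟨hgen x y, fun h => ?_⟩⟩
  -- The generator of `T` has no larger domain than `A`. Here `x' - y' = x - y`, so `d = x - x'` is
  -- mapped by the generator to `y - y' = d`. Contractivity of `T` makes the generator dissipative,
  -- whence `‖d‖² ≤ 0`.
  obtain ⟨x', y', hA', he⟩ := hA.surjective 1 one_pos (x - y)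
  have hd : GeneratorAt T (x - x') (y - y') := by
    refine (Tendsto.sub h (hgen x' y' hA')).congr fun r => ?_
    rw [← smul_sub, map_sub]; congr 1; abel
  have h1 : inner ℝ (x - x') (y - y') ≤ 0 := by
    refine le_of_tendsto (tendsto_const_nhds.inner hd) ?_
    filter_upwards [self_mem_nhdsWithin] with r (hr : 0 < r)
    rw [inner_smul_right, inner_sub_right, real_inner_self_eq_norm_sq]
    refine mul_nonpos_of_nonneg_of_nonpos (inv_nonneg.2 hr.le) ?_
    have h2 := real_inner_le_norm (x - x') (T r (x - x'))
    have h3 := mul_le_mul_of_nonneg_left (hTn r (x - x') hr.le) (norm_nonneg (x - x'))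
    nlinarith
  have h2 : y - y' = x - x' := by
    rw [one_smul] at he
    rw [sub_eq_sub_iff_add_eq_add] at he ⊢
    rw [add_comm y, ← he, add_comm]
  rw [h2, real_inner_self_eq_norm_sq] at h1
  have hx : x = x' := by
    rw [← sub_eq_zero, ← norm_eq_zero]
    exact pow_eq_zero_iff two_ne_zero |>.1 (le_antisymm h1 (sq_nonneg _))
  subst hx
  rw [sub_self, sub_eq_zero] at h2
  exact h2 ▸ hA'

end IsMDissipative

end HilleYosida

/-! ### Mild solutions of semilinear equations with a locally Lipschitz nonlinearity. -/

section Semilinear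

variable {E : Type*} [NormedAddCommGroup E] [NormedSpace ℝ E]

theorem timeInterval_mono {σ τ : EReal} (h : σ ≤ τ) : timeInterval σ ⊆ timeInterval τ :=
  fun _ ht => ⟨ht.1, ht.2.trans_le h⟩

theorem Icc_subset_timeInterval {τ : EReal} {t : ℝ} (ht : t ∈ timeInterval τ) :
    Icc 0 t ⊆ timeInterval τ :=
  fun _ hs => ⟨hs.1, (EReal.coe_le_coe_iff.2 hs.2).trans_lt ht.2⟩

theorem timeInterval_mem_nhdsWithin {σ τ : EReal} {t : ℝ} (ht : t ∈ timeInterval σ) :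
    timeInterval σ ∈ 𝓝[timeInterval τ] t := by
  have h : {s : ℝ | (s : EReal) < σ} ∈ 𝓝 t :=
    (isOpen_Iio.preimage continuous_coe_real_ereal).mem_nhds ht.2
  filter_upwards [mem_nhdsWithin_of_mem_nhds h, self_mem_nhdsWithin] with s hs hs'
  exact ⟨hs'.1, hs⟩

/-- `V` is a mild solution of `V' = A V + F V`, `V 0 = V₀`, on `[0, τ)`, where `A` generates `T`. -/
def IsMild (T : ℝ → E →L[ℝ] E) (F : E → E) (V₀ : E) (τ : EReal) (V : ℝ → E) : Prop :=
  ContinuousOn V (timeInterval τ) ∧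
    ∀ t ∈ timeInterval τ, V t = T t V₀ + ∫ s in (0 : ℝ)..t, T (t - s) (F (V s))

/-- `F` is Lipschitz on bounded sets. -/
def LipschitzOnBalls {H H' : Type*} [NormedAddCommGroup H] [NormedAddCommGroup H'] (F : H → H') : Prop :=
  ∀ R : ℝ, ∃ L : NNReal, LipschitzOnWith L F (Metric.closedBall 0 R)

theorem LipschitzOnBalls.continuous {H H' : Type*} [NormedAddCommGroup H] [NormedAddCommGroup H']
    {F : H → H'}
    (hF : LipschitzOnBalls F) : Continuous F := by
  rw [continuous_iff_continuousAt]
  intro x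
  obtain ⟨L, hL⟩ := hF (‖x‖ + 1)
  refine hL.continuousOn.continuousAt ?_
  filter_upwards [Metric.ball_mem_nhds x one_pos] with y hy
  rw [mem_closedBall_zero_iff]
  rw [mem_ball_iff_norm] at hy
  linarith [norm_le_norm_add_norm_sub' y x]

theorem LipschitzOnBalls.add {H H' : Type*} [NormedAddCommGroup H] [NormedAddCommGroup H']
    {F F' : H → H'} (hF : LipschitzOnBalls F) (hF' : LipschitzOnBalls F') :
    LipschitzOnBalls fun x => F x + F' x := fun R => by
  obtain ⟨L, hL⟩ := hF R
  obtain ⟨L', hL'⟩ := hF' R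
  exact ⟨L + L', hL.add hL'⟩

variable {E₁ E₂ E₃ : Type*} [NormedAddCommGroup E₁] [NormedSpace ℝ E₁] [NormedAddCommGroup E₂]
  [NormedSpace ℝ E₂] [NormedAddCommGroup E₃] [NormedSpace ℝ E₃]

theorem lipschitzOnBalls_clm (P : E →L[ℝ] E₁) : LipschitzOnBalls P := fun _ =>
  ⟨‖P‖₊, P.lipschitz.lipschitzOnWith⟩

theorem LipschitzOnBalls.clm_comp {H : Type*} [NormedAddCommGroup H] (P : E₁ →L[ℝ] E₂)
    {F : H → E₁} (hF : LipschitzOnBalls F) :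
    LipschitzOnBalls fun x => P (F x) := fun R => by
  obtain ⟨L, hL⟩ := hF R
  exact ⟨‖P‖₊ * L, P.lipschitz.comp_lipschitzOnWith hL⟩

theorem lipschitzOnBalls_bilin (m : E₁ →L[ℝ] E₂ →L[ℝ] E₃) (P : E →L[ℝ] E₁) (Q : E →L[ℝ] E₂) :
    LipschitzOnBalls fun x => m (P x) (Q x) := by
  intro R
  refine ⟨(2 * ‖m‖ * ‖P‖ * ‖Q‖ * |R|).toNNReal, LipschitzOnWith.of_dist_le_mul fun x hx y hy => ?_⟩
  rw [Real.coe_toNNReal _ (by positivity), dist_eq_norm, dist_eq_norm]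
  rw [mem_closedBall_zero_iff] at hx hy
  have hx' := hx.trans (le_abs_self R)
  have hy' := hy.trans (le_abs_self R)
  have h : m (P x) (Q x) - m (P y) (Q y) = m (P (x - y)) (Q x) + m (P y) (Q (x - y)) := by
    simp only [map_sub, sub_apply]
    abel
  have hb : ∀ a b, ‖m (P a) (Q b)‖ ≤ ‖m‖ * (‖P‖ * ‖a‖) * (‖Q‖ * ‖b‖) := fun a b =>
    (m.le_opNorm₂ _ _).trans (by gcongr <;> exact ContinuousLinearMap.le_opNorm _ _)
  rw [h]
  calc _ ≤ ‖m‖ * (‖P‖ * ‖x - y‖) * (‖Q‖ * |R|) + ‖m‖ * (‖P‖ * |R|) * (‖Q‖ * ‖x - y‖) := by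
        refine (norm_add_le _ _).trans (add_le_add ((hb _ _).trans ?_) ((hb _ _).trans ?_)) <;>
          gcongr
    _ = _ := by ring

variable {T : ℝ → E →L[ℝ] E} {F : E → E} {V₀ : E}

theorem IsContractionSemigroup.intervalIntegrable (hT : IsContractionSemigroup T) {g : ℝ → E}
    {t : ℝ} (ht : 0 ≤ t) (hg : ContinuousOn g (Icc 0 t)) :
    IntervalIntegrable (fun s => T (t - s) (g s)) volume 0 t := by
  refine ContinuousOn.intervalIntegrable ?_
  rw [uIcc_of_le ht]
  exact hT.continuousOn_apply (by fun_prop) hg fun s hs => sub_nonneg.2 hs.2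

theorem IsMild.mono {σ τ : EReal} {V : ℝ → E} (h : IsMild T F V₀ τ V) (hστ : σ ≤ τ) :
    IsMild T F V₀ σ V :=
  ⟨h.1.mono (timeInterval_mono hστ), fun t ht => h.2 t (timeInterval_mono hστ ht)⟩

theorem IsMild.congr {τ : EReal} {V V' : ℝ → E} (h : IsMild T F V₀ τ V)
    (he : EqOn V' V (timeInterval τ)) : IsMild T F V₀ τ V' := by
  refine ⟨h.1.congr he, fun t ht => ?_⟩
  rw [he ht, h.2 t ht]
  congr 1
  refine intervalIntegral.integral_congr fun s hs => ?_
  rw [uIcc_of_le ht.1] at hs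
  simp only [he (Icc_subset_timeInterval ht hs)]

/-- On a compact interval both solutions stay in one ball, where `F` has a single Lipschitz
constant; contractivity of `T` then leaves a scalar Grönwall inequality for the norm of the
difference. -/
theorem IsMild.eqOn (hT : IsContractionSemigroup T) (hF : LipschitzOnBalls F) {τ : EReal}
    {V V' : ℝ → E} (h : IsMild T F V₀ τ V) (h' : IsMild T F V₀ τ V') :
    EqOn V V' (timeInterval τ) := by
  intro t₀ ht₀
  have hsub := Icc_subset_timeInterval ht₀
  obtain ⟨R, hR⟩ := isCompact_Icc.exists_bound_of_continuousOn (h.1.mono hsub)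
  obtain ⟨R', hR'⟩ := isCompact_Icc.exists_bound_of_continuousOn (h'.1.mono hsub)
  obtain ⟨L, hL⟩ := hF (max R R')
  -- Projecting time onto `[0, t₀]` makes `D` continuous on the whole line, so its primitive is
  -- differentiable everywhere.
  set D : ℝ → ℝ := fun s => ‖V (projIcc 0 t₀ ht₀.1 s) - V' (projIcc 0 t₀ ht₀.1 s)‖ with hD
  have hproj : ∀ s ∈ Icc 0 t₀, (projIcc 0 t₀ ht₀.1 s : ℝ) = s := fun s hs => by
    rw [projIcc_of_mem _ hs]
  have hDc : Continuous D := by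
    have hc : ∀ W : ℝ → E, ContinuousOn W (timeInterval τ) →
        Continuous fun s => W (projIcc 0 t₀ ht₀.1 s) := fun W hW =>
      (hW.mono hsub).comp_continuous (continuous_subtype_val.comp continuous_projIcc)
        fun s => (projIcc 0 t₀ ht₀.1 s).2
    exact ((hc V h.1).sub (hc V' h'.1)).norm
  have hDle : ∀ t ∈ Icc 0 t₀, D t ≤ ∫ s in (0 : ℝ)..t, L * D s := by
    intro t ht
    have htτ := hsub ht
    have hi : ∀ W : ℝ → E, ContinuousOn W (timeInterval τ) →
        IntervalIntegrable (fun s => T (t - s) (F (W s))) volume 0 t := fun W hW =>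
      hT.intervalIntegrable ht.1
        (hF.continuous.comp_continuousOn (hW.mono (Icc_subset_timeInterval htτ)))
    simp only [hD, hproj t ht]
    rw [h.2 t htτ, h'.2 t htτ, add_sub_add_left_eq_sub,
      ← intervalIntegral.integral_sub (hi V h.1) (hi V' h'.1)]
    refine intervalIntegral.norm_integral_le_of_norm_le ht.1 (Eventually.of_forall fun s hs => ?_)
      ((continuous_const.mul hDc).intervalIntegrable _ _)
    have hs' : s ∈ Icc 0 t₀ := ⟨hs.1.le, hs.2.trans ht.2⟩
    rw [← map_sub, hproj s hs', ← dist_eq_norm (V s)]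
    refine (hT.norm_le _ _ (sub_nonneg.2 hs.2)).trans ?_
    rw [← dist_eq_norm]
    refine hL.dist_le_mul _ ?_ _ ?_ <;> rw [mem_closedBall_zero_iff]
    · exact (hR s hs').trans (le_max_left _ _)
    · exact (hR' s hs').trans (le_max_right _ _)
  have hder : ∀ t, HasDerivAt (fun t => ∫ s in (0 : ℝ)..t, L * D s) (L * D t) t := fun t =>
    intervalIntegral.integral_hasDerivAt_right (Continuous.intervalIntegrable (by fun_prop) _ _)
      (Continuous.stronglyMeasurableAtFilter (by fun_prop) _ _) (by fun_prop)
  -- Grönwall is applied to the primitive `G` of `L * D` rather than to `D`: `G 0 = 0` and `G' = L *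
  -- D ≤ L * G`.
  have hgr := norm_le_gronwallBound_of_norm_deriv_right_le (δ := 0) (K := L) (ε := 0)
    (a := 0) (b := t₀) (fun t _ => (hder t).continuousAt.continuousWithinAt)
    (fun t _ => (hder t).hasDerivWithinAt) (by simp) (fun t ht => by
      rw [add_zero, norm_mul, NNReal.norm_eq]
      have := hDle t ⟨ht.1, ht.2.le⟩
      gcongr
      rw [Real.norm_of_nonneg (norm_nonneg _)]
      exact this.trans (le_abs_self _)) t₀ ⟨ht₀.1, le_rfl⟩
  rw [gronwallBound_ε0_δ0] at hgr
  have h1 := (hDle t₀ ⟨ht₀.1, le_rfl⟩).trans ((le_abs_self _).trans hgr)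
  simp only [hD, hproj t₀ ⟨ht₀.1, le_rfl⟩] at h1
  exact sub_eq_zero.1 (norm_le_zero_iff.1 h1)

/-- Banach's fixed point theorem for the Duhamel map on a closed ball of `C([0, δ], E)`. -/
theorem exists_isMild_local [CompleteSpace E] (hT : IsContractionSemigroup T)
    (hF : LipschitzOnBalls F) (V₀ : E) :
    ∃ δ : ℝ, 0 < δ ∧ ∃ V, IsMild T F V₀ δ V := by
  set R : ℝ := ‖V₀‖ + 1 with hR
  obtain ⟨L, hL⟩ := hF R
  have hR0 : 0 < R := by positivity
  set M : ℝ := ‖F 0‖ + L * R with hM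
  have hM0 : 0 ≤ M := by positivity
  have hFM : ∀ x, ‖x‖ ≤ R → ‖F x‖ ≤ M := fun x hx => by
    have h1 := hL.dist_le_mul x (by simpa using hx) 0 (by simpa using hR0.le)
    rw [dist_eq_norm, dist_zero_right] at h1
    have h2 := norm_le_norm_add_norm_sub' (F x) (F 0)
    have h3 : (L : ℝ) * ‖x‖ ≤ L * R := by gcongr
    linarith
  -- Chosen so that `M δ ≤ 1`, which keeps the ball of radius `‖V₀‖ + 1` invariant, and `L δ ≤ 1/2`,
  -- the contraction factor.
  set δ : ℝ := 1 / (M + 2 * L + 1) with hδ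
  have hL0 : (0 : ℝ) ≤ L := L.2
  have hδ0 : 0 < δ := by positivity
  have hδe : δ * (M + 2 * L + 1) = 1 := by rw [hδ]; field_simp
  have hδM : M * δ ≤ 1 := by nlinarith [mul_nonneg hδ0.le hL0]
  have hδL : L * δ ≤ 1 / 2 := by nlinarith [mul_nonneg hδ0.le hM0]
  let g : C(Icc (0 : ℝ) δ, E) → ℝ → E := fun V s => F (V (projIcc 0 δ hδ0.le s))
  have hg : ∀ V, Continuous (g V) := fun V => by
    have := hF.continuous
    have h2 : Continuous (projIcc 0 δ hδ0.le) := continuous_projIcc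
    exact this.comp (V.continuous.comp h2)
  have hΦc : ∀ V, Continuous fun t : Icc (0 : ℝ) δ =>
      T (max (t : ℝ) 0) V₀ + ∫ s in (0 : ℝ)..t, T (max ((t : ℝ) - s) 0) (g V s) := by
    intro V
    have hV := hg V
    refine Continuous.add ?_ ?_
    · exact hT.continuous_max.comp (by fun_prop : Continuous fun t : Icc (0 : ℝ) δ => ((t : ℝ), V₀))
    · refine intervalIntegral.continuous_parametric_intervalIntegral_of_continuous ?_
        continuous_subtype_val
      exact hT.continuous_max.comp
        (by fun_prop : Continuous fun p : Icc (0 : ℝ) δ × ℝ => ((p.1 : ℝ) - p.2, g V p.2))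
  let Φ : C(Icc (0 : ℝ) δ, E) → C(Icc (0 : ℝ) δ, E) := fun V => ⟨_, hΦc V⟩
  have hint : ∀ V (t : Icc (0 : ℝ) δ), IntervalIntegrable
      (fun s => T (max ((t : ℝ) - s) 0) (g V s)) volume 0 t := fun V t => by
    have hV := hg V
    refine Continuous.intervalIntegrable ?_ _ _
    exact hT.continuous_max.comp (by fun_prop : Continuous fun s => ((t : ℝ) - s, g V s))
  set K : Set C(Icc (0 : ℝ) δ, E) := Metric.closedBall 0 R with hK
  have hball : ∀ V ∈ K, ∀ t, ‖V t‖ ≤ R := fun V hV t =>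
    (V.norm_coe_le_norm t).trans (by simpa [hK] using hV)
  have hmaps : MapsTo Φ K K := by
    intro V hV
    rw [hK, mem_closedBall_zero_iff, ContinuousMap.norm_le _ hR0.le]
    intro t
    refine (norm_add_le _ _).trans (add_le_add (hT.norm_le _ _ (le_max_right _ _)) ?_)
    refine (intervalIntegral.norm_integral_le_of_norm_le_const (C := M) fun s _ => ?_).trans ?_
    · exact (hT.norm_le _ _ (le_max_right _ _)).trans (hFM _ (hball V hV _))
    · rw [sub_zero, abs_of_nonneg t.2.1]
      exact (mul_le_mul_of_nonneg_left t.2.2 hM0).trans hδM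
  have hcontr : ContractingWith (1 / 2) (hmaps.restrict Φ K K) := by
    refine ⟨by simp [← NNReal.coe_lt_coe]; norm_num, LipschitzWith.of_dist_le_mul ?_⟩
    rintro ⟨V, hV⟩ ⟨W, hW⟩
    change dist (Φ V) (Φ W) ≤ ((1 / 2 : NNReal) : ℝ) * dist V W
    rw [ContinuousMap.dist_le (by positivity)]
    intro t
    change dist (T (max (t : ℝ) 0) V₀ + ∫ s in (0 : ℝ)..t, T (max ((t : ℝ) - s) 0) (g V s))
      (T (max (t : ℝ) 0) V₀ + ∫ s in (0 : ℝ)..t, T (max ((t : ℝ) - s) 0) (g W s)) ≤ _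
    rw [dist_add_left, dist_eq_norm, ← intervalIntegral.integral_sub (hint V t) (hint W t)]
    refine (intervalIntegral.norm_integral_le_of_norm_le_const (C := L * dist V W)
      fun s _ => ?_).trans ?_
    · rw [← map_sub]
      refine (hT.norm_le _ _ (le_max_right _ _)).trans ?_
      rw [← dist_eq_norm]
      refine (hL.dist_le_mul _ ?_ _ ?_).trans (mul_le_mul_of_nonneg_left (V.dist_apply_le_dist _) hL0)
      · simpa using hball V hV _
      · simpa using hball W hW _
    · rw [sub_zero, abs_of_nonneg t.2.1]
      have := t.2.2
      calc L * dist V W * t ≤ L * dist V W * δ := by gcongr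
        _ = (L * δ) * dist V W := by ring
        _ ≤ _ := by push_cast; gcongr
  obtain ⟨V, -, hV, -⟩ := ContractingWith.exists_fixedPoint' (x := 0)
    Metric.isClosed_closedBall.isComplete hmaps hcontr (by simp [hK, hR0.le]) (edist_ne_top _ _)
  refine ⟨δ, hδ0, fun t => V (projIcc 0 δ hδ0.le t), ?_, ?_⟩
  · exact (V.continuous.comp continuous_projIcc).continuousOn
  · intro t ht
    have ht' : t ∈ Icc 0 δ := ⟨ht.1, (EReal.coe_lt_coe_iff.1 ht.2).le⟩
    have h1 : V ⟨t, ht'⟩ = Φ V ⟨t, ht'⟩ := by rw [hV]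
    simp only [projIcc_of_mem _ ht', h1]
    change T (max t 0) V₀ + ∫ s in (0 : ℝ)..t, T (max (t - s) 0) (g V s) = _
    rw [max_eq_left ht.1]
    congr 1
    refine intervalIntegral.integral_congr fun s hs => ?_
    rw [uIcc_of_le ht.1] at hs
    simp only [max_eq_left (sub_nonneg.2 hs.2), g]

/-- Existence and uniqueness of the maximal mild solution. -/
theorem exists_isMild_maximal [CompleteSpace E] (hT : IsContractionSemigroup T)
    (hF : LipschitzOnBalls F) (V₀ : E) :
    ∃ tmax : EReal, 0 < tmax ∧ ∃ V, IsMild T F V₀ tmax V ∧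
      ∀ τ V', IsMild T F V₀ τ V' → τ ≤ tmax ∧ EqOn V' V (timeInterval τ) := by
  classical
  -- The maximal time is the supremum of all existence times. It is itself an existence time: each
  -- `t` below it is served by a solution on some `[0, σ t)`, and uniqueness makes these choices
  -- consistent.
  set P : Set EReal := {τ | ∃ V, IsMild T F V₀ τ V}
  choose! W hW using fun (τ : EReal) (h : τ ∈ P) => h
  have hex : ∀ t ∈ timeInterval (sSup P), ∃ τ, τ ∈ P ∧ t ∈ timeInterval τ := fun t ht => by
    obtain ⟨τ, hτ, h⟩ := lt_sSup_iff.1 ht.2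
    exact ⟨τ, hτ, ht.1, h⟩
  choose! σ hσP hσ using hex
  have hEq : ∀ τ V', IsMild T F V₀ τ V' → EqOn V' (fun t => W (σ t) t) (timeInterval τ) := by
    intro τ V' hV' t ht
    have hts := timeInterval_mono (le_sSup (show τ ∈ P from ⟨V', hV'⟩)) ht
    exact IsMild.eqOn hT hF (hV'.mono (min_le_left τ (σ t)))
      ((hW _ (hσP t hts)).mono (min_le_right τ (σ t))) ⟨ht.1, lt_min ht.2 (hσ t hts).2⟩
  refine ⟨sSup P, ?_, fun t => W (σ t) t, ⟨?_, ?_⟩, fun τ V' hV' =>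
    ⟨le_sSup ⟨V', hV'⟩, hEq τ V' hV'⟩⟩
  · obtain ⟨δ, hδ, V, hV⟩ := exists_isMild_local hT hF V₀
    exact (EReal.coe_pos.2 hδ).trans_le (le_sSup ⟨V, hV⟩)
  · intro t ht
    have h1 := hW _ (hσP t ht)
    have h2 := (h1.congr (hEq _ _ h1).symm).1 t (hσ t ht)
    exact h2.mono_of_mem_nhdsWithin (timeInterval_mem_nhdsWithin (hσ t ht))
  · intro t ht
    have h1 := hW _ (hσP t ht)
    exact (h1.congr (hEq _ _ h1).symm).2 t (hσ t ht)

end Semilinear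

/-! ### A weighted Riesz representation. -/

section RieszRepresentation

variable {H : Type*} [NormedAddCommGroup H] [InnerProductSpace ℝ H] [CompleteSpace H]

/-- Riesz representation on a closed subspace of `H × H` for a weighted inner product. -/
theorem exists_mem_forall_inner_eq (K : Submodule ℝ (H × H)) (hK : IsClosed (K : Set (H × H)))
    {l : ℝ} (hl : 0 < l) (f g : H) :
    ∃ p ∈ K, ∀ q ∈ K, l * inner ℝ p.1 q.1 + inner ℝ p.2 q.2 = inner ℝ f q.1 + inner ℝ g q.2 := by
  -- Scaling the first factor by `√l` turns the weighted product into the standard one; `p` is the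
  -- orthogonal projection of the rescaled data `(f / c, g)`, rescaled back.
  set c := √l with hc
  have hc0 : c ≠ 0 := (Real.sqrt_pos.2 hl).ne'
  have hcc : c * c = l := Real.mul_self_sqrt hl.le
  let L : WithLp 2 (H × H) →L[ℝ] H × H :=
    (c⁻¹ • WithLp.fstL 2 ℝ H H).prod (WithLp.sndL 2 ℝ H H)
  let K' : Submodule ℝ (WithLp 2 (H × H)) := K.comap (L : WithLp 2 (H × H) →ₗ[ℝ] H × H)
  have hK' : IsClosed (K' : Set (WithLp 2 (H × H))) := hK.preimage L.continuous
  have : CompleteSpace K' := hK'.completeSpace_coe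
  set z := WithLp.toLp 2 (c⁻¹ • f, g)
  set p := K'.starProjection z
  have hp : p ∈ K' := K'.starProjection_apply_mem z
  refine ⟨(c⁻¹ • p.fst, p.snd), hp, fun q hq => ?_⟩
  have hq' : WithLp.toLp 2 (c • q.1, q.2) ∈ K' := by
    change (c⁻¹ • c • q.1, q.2) ∈ K
    rwa [inv_smul_smul₀ hc0]
  have h := K'.starProjection_inner_eq_zero z _ hq'
  rw [inner_sub_left, sub_eq_zero, WithLp.prod_inner_apply, WithLp.prod_inner_apply] at h
  change inner ℝ (c⁻¹ • f) (c • q.1) + inner ℝ g q.2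
    = inner ℝ p.fst (c • q.1) + inner ℝ p.snd q.2 at h
  simp only [real_inner_smul_left, real_inner_smul_right] at h ⊢
  rw [mul_inv_cancel_left₀ hc0] at h
  rw [h, ← hcc, mul_assoc, mul_inv_cancel_left₀ hc0]

end RieszRepresentation

/-! ### Weak derivatives and m-dissipativity of the second derivative. -/

section FunctionSpaces

variable {Ω : TopologicalSpace.Opens ℝ}

theorem inner_L2_eq (f g : L2 Ω) : inner ℝ f g = ∫ x in (Ω : Set ℝ), f x * g x := by
  rw [L2.inner_def]
  simp [mul_comm]

theorem integral_mul_eq_inner {f g : L2 Ω} {a b : ℝ → ℝ}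
    (hf : f =ᵐ[volume.restrict (Ω : Set ℝ)] a) (hg : g =ᵐ[volume.restrict (Ω : Set ℝ)] b) :
    ∫ x in (Ω : Set ℝ), a x * b x = inner ℝ f g := by
  rw [inner_L2_eq]
  refine integral_congr_ae ?_
  filter_upwards [hf, hg] with x h1 h2
  rw [h1, h2]

/-- The derivative of a test function, as a test function. -/
def testDeriv (φ : 𝓓(Ω, ℝ)) : 𝓓(Ω, ℝ) where
  toFun := deriv φ
  contDiff' := (contDiff_infty_iff_deriv.1 φ.contDiff).2
  hasCompactSupport' := φ.hasCompactSupport.deriv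
  tsupport_subset' := tsupport_deriv_subset.trans φ.tsupport_subset

@[simp]
theorem coe_testDeriv (φ : 𝓓(Ω, ℝ)) : (testDeriv φ : ℝ → ℝ) = deriv φ := rfl

theorem test_eq_zero_of_notMem (φ : 𝓓(Ω, ℝ)) {x : ℝ} (hx : x ∉ (Ω : Set ℝ)) : φ x = 0 :=
  image_eq_zero_of_notMem_tsupport fun h => hx (φ.tsupport_subset h)

theorem test_differentiable (φ : 𝓓(Ω, ℝ)) : Differentiable ℝ φ :=
  φ.contDiff.differentiable (by simp)

theorem setIntegral_mul_test (f : ℝ → ℝ) (φ : 𝓓(Ω, ℝ)) :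
    ∫ x in (Ω : Set ℝ), f x * φ x = ∫ x, f x * φ x :=
  setIntegral_eq_integral_of_forall_compl_eq_zero fun x hx => by
    rw [test_eq_zero_of_notMem φ hx, mul_zero]

theorem integrable_test_mul (φ ψ : 𝓓(Ω, ℝ)) : Integrable (fun x => φ x * ψ x) :=
  (φ.continuous.mul ψ.continuous).integrable_of_hasCompactSupport φ.hasCompactSupport.mul_right

theorem integral_test_mul_deriv (φ ψ : 𝓓(Ω, ℝ)) :
    ∫ x in (Ω : Set ℝ), φ x * deriv ψ x = -∫ x in (Ω : Set ℝ), deriv φ x * ψ x := by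
  have h1 := setIntegral_mul_test φ (testDeriv ψ)
  have h2 := setIntegral_mul_test (deriv φ) ψ
  rw [coe_testDeriv] at h1
  rw [h1, h2]
  exact integral_mul_deriv_eq_deriv_mul_of_integrable
    (fun x _ => (test_differentiable φ x).hasDerivAt)
    (fun x _ => (test_differentiable ψ x).hasDerivAt)
    (integrable_test_mul φ (testDeriv ψ)) (integrable_test_mul (testDeriv φ) ψ)
    (integrable_test_mul φ ψ)

theorem memLp_test (φ : 𝓓(Ω, ℝ)) : MemLp φ 2 (volume.restrict (Ω : Set ℝ)) :=
  (φ.continuous.memLp_of_hasCompactSupport φ.hasCompactSupport).restrict _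

/-- The class in `L²(Ω)` of a test function. -/
def testLp (φ : 𝓓(Ω, ℝ)) : L2 Ω := (memLp_test φ).toLp φ

theorem coeFn_testLp (φ : 𝓓(Ω, ℝ)) : testLp φ =ᵐ[volume.restrict (Ω : Set ℝ)] φ :=
  MemLp.coeFn_toLp _

theorem integral_mul_test_eq_inner (f : L2 Ω) (φ : 𝓓(Ω, ℝ)) :
    ∫ x in (Ω : Set ℝ), f x * φ x = inner ℝ f (testLp φ) :=
  integral_mul_eq_inner (EventuallyEq.refl _ _) (coeFn_testLp φ)

theorem inner_testLp_testDeriv (φ ψ : 𝓓(Ω, ℝ)) :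
    inner ℝ (testLp φ) (testLp (testDeriv ψ)) = -inner ℝ (testLp (testDeriv φ)) (testLp ψ) := by
  rw [← integral_mul_eq_inner (coeFn_testLp φ) (coeFn_testLp _),
    ← integral_mul_eq_inner (coeFn_testLp _) (coeFn_testLp ψ)]
  exact integral_test_mul_deriv φ ψ

/-- Fundamental lemma of the calculus of variations. -/
theorem eq_zero_of_inner_testLp {f : L2 Ω} (h : ∀ φ : 𝓓(Ω, ℝ), inner ℝ f (testLp φ) = 0) :
    f = 0 := by
  rw [Lp.eq_zero_iff_ae_eq_zero]
  have hloc : LocallyIntegrableOn f (Ω : Set ℝ) (volume.restrict (Ω : Set ℝ)) :=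
    ((Lp.memLp f).locallyIntegrable (by norm_num)).locallyIntegrableOn _
  have := Ω.isOpen.ae_eq_zero_of_integral_contDiff_smul_eq_zero hloc fun g hg hgc hgΩ => by
    have := h ⟨g, hg, hgc, hgΩ⟩
    rw [← integral_mul_test_eq_inner] at this
    simpa [mul_comm] using this
  filter_upwards [this, ae_restrict_mem Ω.isOpen.measurableSet] with x h1 h2
  exact h1 h2

theorem hasWeakDeriv_iff {u g : L2 Ω} : HasWeakDeriv u g ↔
    ∀ φ : 𝓓(Ω, ℝ), inner ℝ u (testLp (testDeriv φ)) = -inner ℝ g (testLp φ) := by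
  refine forall_congr' fun φ => ?_
  rw [← integral_mul_test_eq_inner, ← integral_mul_test_eq_inner]
  rfl

theorem HasWeakDeriv.unique {u g g' : L2 Ω} (h : HasWeakDeriv u g) (h' : HasWeakDeriv u g') :
    g = g' := by
  rw [hasWeakDeriv_iff] at h h'
  refine sub_eq_zero.1 (eq_zero_of_inner_testLp fun φ => ?_)
  rw [inner_sub_left]
  linarith [h φ, h' φ]

theorem HasWeakDeriv.add {u g u' g' : L2 Ω} (h : HasWeakDeriv u g) (h' : HasWeakDeriv u' g') :
    HasWeakDeriv (u + u') (g + g') := by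
  rw [hasWeakDeriv_iff] at *
  intro φ
  rw [inner_add_left, inner_add_left, h, h']
  ring

theorem HasWeakDeriv.smul {u g : L2 Ω} (c : ℝ) (h : HasWeakDeriv u g) :
    HasWeakDeriv (c • u) (c • g) := by
  rw [hasWeakDeriv_iff] at *
  intro φ
  rw [real_inner_smul_left, real_inner_smul_left, h]
  ring

variable (Ω) in
/-- The graph of the derivative on test functions. -/
def testGraph : Submodule ℝ (L2 Ω × L2 Ω) where
  carrier := {p : L2 Ω × L2 Ω | ∃ φ : 𝓓(Ω, ℝ),
    p.1 =ᵐ[volume.restrict (Ω : Set ℝ)] φ ∧ p.2 =ᵐ[volume.restrict (Ω : Set ℝ)] deriv φ}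
  zero_mem' := by
    refine ⟨0, Lp.coeFn_zero _ _ _, ?_⟩
    have : deriv ((0 : 𝓓(Ω, ℝ)) : ℝ → ℝ) = 0 := by rw [FunLike.coe_zero]; funext x; simp
    rw [this]
    exact Lp.coeFn_zero _ _ _
  add_mem' := by
    rintro p q ⟨φ, h1, h2⟩ ⟨ψ, h3, h4⟩
    refine ⟨φ + ψ, (Lp.coeFn_add _ _).trans (h1.add h3), ?_⟩
    have : deriv ((φ + ψ : 𝓓(Ω, ℝ)) : ℝ → ℝ) = deriv φ + deriv ψ := by
      rw [FunLike.coe_add]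
      funext x
      exact deriv_add (test_differentiable φ x) (test_differentiable ψ x)
    rw [this]
    exact (Lp.coeFn_add _ _).trans (h2.add h4)
  smul_mem' := by
    rintro c p ⟨φ, h1, h2⟩
    refine ⟨c • φ, (Lp.coeFn_smul _ _).trans (h1.const_smul c), ?_⟩
    have : deriv ((c • φ : 𝓓(Ω, ℝ)) : ℝ → ℝ) = c • deriv φ := by
      rw [FunLike.coe_smul]
      funext x
      exact deriv_const_smul c (test_differentiable φ x)
    rw [this]
    exact (Lp.coeFn_smul _ _).trans (h2.const_smul c)

/-- The graph of the closure of the derivative on test functions. -/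
def MemGraph (u g : L2 Ω) : Prop := (u, g) ∈ (testGraph Ω).topologicalClosure

theorem testLp_mem_graph (φ : 𝓓(Ω, ℝ)) : (testLp φ, testLp (testDeriv φ)) ∈ testGraph Ω :=
  ⟨φ, coeFn_testLp φ, coeFn_testLp _⟩

theorem exists_testLp_of_mem_graph {p : L2 Ω × L2 Ω} (hp : p ∈ testGraph Ω) :
    ∃ φ : 𝓓(Ω, ℝ), p = (testLp φ, testLp (testDeriv φ)) := by
  obtain ⟨φ, h1, h2⟩ := hp
  exact ⟨φ, Prod.ext (Lp.ext (h1.trans (coeFn_testLp φ).symm))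
    (Lp.ext (h2.trans (coeFn_testLp (testDeriv φ)).symm))⟩

/-- The weak derivative is minus the adjoint of the closed operator `D` with graph `MemGraph`:
testing against smooth functions extends to the closure by continuity. -/
theorem hasWeakDeriv_iff_graph {u g : L2 Ω} : HasWeakDeriv u g ↔
    ∀ p q, MemGraph p q → inner ℝ u q = -inner ℝ g p := by
  rw [hasWeakDeriv_iff]
  constructor
  · intro h p q hpq
    have hcl : IsClosed {z : L2 Ω × L2 Ω | inner ℝ u z.2 = -inner ℝ g z.1} :=
      isClosed_eq (by fun_prop) (by fun_prop)
    refine closure_minimal ?_ hcl hpq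
    intro z hz
    obtain ⟨φ, rfl⟩ := exists_testLp_of_mem_graph hz
    exact h φ
  · exact fun h φ => h _ _ (subset_closure (testLp_mem_graph φ))

theorem MemGraph.hasWeakDeriv {u g : L2 Ω} (h : MemGraph u g) : HasWeakDeriv u g := by
  rw [hasWeakDeriv_iff]
  intro φ
  have hcl : IsClosed {z : L2 Ω × L2 Ω |
      inner ℝ z.1 (testLp (testDeriv φ)) = -inner ℝ z.2 (testLp φ)} :=
    isClosed_eq (by fun_prop) (by fun_prop)
  refine closure_minimal ?_ hcl h
  intro z hz
  obtain ⟨ψ, rfl⟩ := exists_testLp_of_mem_graph hz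
  exact inner_testLp_testDeriv ψ φ

theorem memH10_iff {u : L2 Ω} : MemH10 u ↔ ∃ g, MemGraph u g := Iff.rfl

/-- Uniqueness of weak derivatives identifies the `g` in `MemH10 u` with `u'`, giving the
factorization `-D* D`; the Neumann case gives `-D D*`. -/
theorem hasSecondDeriv_dirichlet {u f : L2 Ω} :
    HasSecondDeriv .dirichlet u f ↔ ∃ u', MemGraph u u' ∧ HasWeakDeriv u' f := by
  constructor
  · rintro ⟨u', h1, h2, g, hg⟩
    have : MemGraph u g := hg
    rw [this.hasWeakDeriv.unique h1] at this
    exact ⟨u', this, h2⟩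
  · rintro ⟨u', h1, h2⟩
    exact ⟨u', h1.hasWeakDeriv, h2, memH10_iff.2 ⟨u', h1⟩⟩

theorem hasSecondDeriv_neumann {u f : L2 Ω} :
    HasSecondDeriv .neumann u f ↔ ∃ u', HasWeakDeriv u u' ∧ MemGraph u' f := by
  constructor
  · rintro ⟨u', h1, h2, g, hg⟩
    have : MemGraph u' g := hg
    rw [this.hasWeakDeriv.unique h2] at this
    exact ⟨u', h1, this⟩
  · rintro ⟨u', h1, h2⟩
    exact ⟨u', h1, h2.hasWeakDeriv, memH10_iff.2 ⟨f, h2⟩⟩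

theorem isMDissipative_hasSecondDeriv (b : BoundaryCondition) :
    IsMDissipative (HasSecondDeriv (Ω := Ω) b) := by
  have hunique : ∀ {u f f' : L2 Ω}, HasSecondDeriv b u f → HasSecondDeriv b u f' → f = f' := by
    rintro u f f' ⟨u', h1, h2, -⟩ ⟨v', h3, h4, -⟩
    rw [h1.unique h3] at h2
    exact h2.unique h4
  have hclosed : IsClosed ((testGraph Ω).topologicalClosure : Set (L2 Ω × L2 Ω)) :=
    Submodule.isClosed_topologicalClosure _
  cases b with
  | dirichlet =>
    refine ⟨?_, ?_, hunique, ?_, ?_⟩ <;> simp only [hasSecondDeriv_dirichlet]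
    · rintro x y x' y' ⟨u, h1, h2⟩ ⟨v, h3, h4⟩
      exact ⟨u + v, add_mem h1 h3, h2.add h4⟩
    · rintro c x y ⟨u, h1, h2⟩
      exact ⟨c • u, Submodule.smul_mem _ c h1, h2.smul c⟩
    · rintro x y ⟨u, h1, h2⟩
      have := hasWeakDeriv_iff_graph.1 h2 _ _ h1
      rw [real_inner_comm]
      linarith [real_inner_self_nonneg (x := u)]
    · intro l hl f
      -- Weak formulation of `l u - u'' = f` on the graph of `D`, with `p = (u, u')`.
      obtain ⟨p, hp, h⟩ := exists_mem_forall_inner_eq _ hclosed hl f 0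
      refine ⟨p.1, l • p.1 - f, ⟨p.2, hp, hasWeakDeriv_iff_graph.2 fun r s hrs => ?_⟩, by simp⟩
      have := h _ hrs
      rw [inner_zero_left] at this
      rw [inner_sub_left, real_inner_smul_left]
      linarith
  | neumann =>
    refine ⟨?_, ?_, hunique, ?_, ?_⟩ <;> simp only [hasSecondDeriv_neumann]
    · rintro x y x' y' ⟨u, h1, h2⟩ ⟨v, h3, h4⟩
      exact ⟨u + v, h1.add h3, add_mem h2 h4⟩
    · rintro c x y ⟨u, h1, h2⟩
      exact ⟨c • u, h1.smul c, Submodule.smul_mem _ c h2⟩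
    · rintro x y ⟨u, h1, h2⟩
      have := hasWeakDeriv_iff_graph.1 h1 _ _ h2
      linarith [real_inner_self_nonneg (x := u)]
    · intro l hl f
      -- Here the unknown is the derivative: `p = (u', u'')` lies in the graph of `D`, and `u` is
      -- recovered from the equation as `(f + u'') / l`.
      obtain ⟨p, hp, h⟩ := exists_mem_forall_inner_eq _ hclosed hl 0 (-f)
      refine ⟨l⁻¹ • (f + p.2), p.2, ⟨p.1, hasWeakDeriv_iff_graph.2 fun r s hrs => ?_, hp⟩, ?_⟩
      · have := h _ hrs
        rw [inner_zero_left, inner_neg_left] at this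
        simp only [real_inner_smul_left, inner_add_left] at this ⊢
        rw [inv_mul_eq_div, div_eq_iff hl.ne']
        linarith
      · rw [smul_inv_smul₀ hl.ne']; simp

theorem isMDissipative_opA (b : BoundaryCondition) : IsMDissipative (opA (Ω := Ω) b) where
  add := by
    rintro x y x' y' ⟨h1, h2⟩ ⟨h3, h4⟩
    exact ⟨(isMDissipative_hasSecondDeriv b).add h1 h3, (isMDissipative_hasSecondDeriv b).add h2 h4⟩
  smul := by
    rintro c x y ⟨h1, h2⟩
    exact ⟨(isMDissipative_hasSecondDeriv b).smul c h1, (isMDissipative_hasSecondDeriv b).smul c h2⟩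
  unique := by
    rintro x y y' ⟨h1, h2⟩ ⟨h3, h4⟩
    exact WithLp.ofLp_injective 2 (Prod.ext ((isMDissipative_hasSecondDeriv b).unique h1 h3)
      ((isMDissipative_hasSecondDeriv b).unique h2 h4))
  dissipative := by
    rintro x y ⟨h1, h2⟩
    rw [WithLp.prod_inner_apply]
    exact add_nonpos ((isMDissipative_hasSecondDeriv b).dissipative h1)
      ((isMDissipative_hasSecondDeriv b).dissipative h2)
  surjective := by
    intro l hl f
    obtain ⟨x, y, h, he⟩ := (isMDissipative_hasSecondDeriv b).surjective l hl f.fst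
    obtain ⟨x', y', h', he'⟩ := (isMDissipative_hasSecondDeriv b).surjective l hl f.snd
    exact ⟨WithLp.toLp 2 (x, x'), WithLp.toLp 2 (y, y'), ⟨h, h'⟩,
      WithLp.ofLp_injective 2 (Prod.ext he he')⟩

end FunctionSpaces

/-! ### The space `H²₀(Ω)`: sup bound, multiplication and the elliptic problem. -/

section SobolevSpace

variable {Ω : TopologicalSpace.Opens ℝ}

theorem coe_testDeriv_iterate (k : ℕ) (φ : 𝓓(Ω, ℝ)) :
    ((testDeriv^[k] φ : 𝓓(Ω, ℝ)) : ℝ → ℝ) = iteratedDeriv k φ := by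
  induction k with
  | zero => simp
  | succ k ih => rw [Function.iterate_succ_apply', coe_testDeriv, ih, iteratedDeriv_succ]

/-- The jet of a test function. -/
def testJet (φ : 𝓓(Ω, ℝ)) : PiLp 2 (fun _ : Fin 3 => L2 Ω) :=
  WithLp.toLp 2 fun k => testLp (testDeriv^[k] φ)

theorem testJet_mem (φ : 𝓓(Ω, ℝ)) : testJet φ ∈ testJets Ω :=
  ⟨φ, fun k => by
    rw [← coe_testDeriv_iterate]
    exact coeFn_testLp _⟩

theorem exists_testJet_of_mem {p : PiLp 2 (fun _ : Fin 3 => L2 Ω)} (hp : p ∈ testJets Ω) :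
    ∃ φ : 𝓓(Ω, ℝ), p = testJet φ := by
  obtain ⟨φ, h⟩ := hp
  refine ⟨φ, PiLp.ext fun k => Lp.ext ((h k).trans ?_)⟩
  rw [← coe_testDeriv_iterate]
  exact (coeFn_testLp _).symm

theorem norm_sq_jet (p : PiLp 2 (fun _ : Fin 3 => L2 Ω)) :
    ‖p‖ ^ 2 = ‖p 0‖ ^ 2 + ‖p 1‖ ^ 2 + ‖p 2‖ ^ 2 := by
  rw [PiLp.norm_sq_eq_of_L2, Fin.sum_univ_three]

namespace H20

/-- Closed relations that hold for jets of test functions hold on `H²₀(Ω)`. -/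
theorem closure_induction {P : PiLp 2 (fun _ : Fin 3 => L2 Ω) → Prop} (hP : IsClosed {p | P p})
    (h : ∀ φ : 𝓓(Ω, ℝ), P (testJet φ)) (w : H20 Ω) : P w := by
  refine closure_minimal ?_ hP w.2
  intro p hp
  obtain ⟨φ, rfl⟩ := exists_testJet_of_mem hp
  exact h φ

/-- A test function as an element of `H²₀(Ω)`. -/
def ofTest (φ : 𝓓(Ω, ℝ)) : H20 Ω := ⟨testJet φ, subset_closure (testJet_mem φ)⟩

/-- The `k`-th derivative, `k ≤ 2`, as an operator from `H²₀(Ω)` to `L²(Ω)`. -/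
def jet (k : Fin 3) : H20 Ω →L[ℝ] L2 Ω :=
  (PiLp.proj 2 (fun _ : Fin 3 => L2 Ω) k).comp (testJets Ω).topologicalClosure.subtypeL

theorem norm_sq_eq (w : H20 Ω) : ‖w‖ ^ 2 = ‖jet 0 w‖ ^ 2 + ‖jet 1 w‖ ^ 2 + ‖jet 2 w‖ ^ 2 :=
  norm_sq_jet _

theorem norm_jet_le (k : Fin 3) (w : H20 Ω) : ‖jet k w‖ ≤ ‖w‖ :=
  PiLp.norm_apply_le (w : PiLp 2 (fun _ : Fin 3 => L2 Ω)) k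

theorem inner_jet_zero (w : H20 Ω) (φ : 𝓓(Ω, ℝ)) :
    inner ℝ (jet 0 w) (testLp (testDeriv^[4] φ)) = inner ℝ (jet 2 w) (testLp (testDeriv^[2] φ)) := by
  refine closure_induction (P := fun p => inner ℝ (p 0) (testLp (testDeriv^[4] φ))
    = inner ℝ (p 2) (testLp (testDeriv^[2] φ))) (isClosed_eq (by fun_prop) (by fun_prop))
    (fun ψ => ?_) w
  change inner ℝ (testLp ψ) (testLp (testDeriv (testDeriv (testDeriv (testDeriv φ)))))
    = inner ℝ (testLp (testDeriv (testDeriv ψ))) (testLp (testDeriv (testDeriv φ)))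
  rw [inner_testLp_testDeriv, inner_testLp_testDeriv, neg_neg]

/-- For test functions `‖φ'‖² = -⟨φ, φ''⟩`. This interpolation is why a form without first
derivatives is still coercive. -/
theorem norm_jet_one_sq_le (w : H20 Ω) : ‖jet 1 w‖ ^ 2 ≤ ‖jet 0 w‖ * ‖jet 2 w‖ := by
  refine closure_induction (P := fun p => ‖p 1‖ ^ 2 ≤ ‖p 0‖ * ‖p 2‖)
    (isClosed_le (by fun_prop) (by fun_prop)) (fun φ => ?_) w
  change ‖testLp (testDeriv φ)‖ ^ 2 ≤ ‖testLp φ‖ * ‖testLp (testDeriv (testDeriv φ))‖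
  rw [← real_inner_self_eq_norm_sq, ← neg_neg (inner ℝ _ _), ← inner_testLp_testDeriv]
  exact (neg_le_abs _).trans (abs_real_inner_le_norm _ _)

theorem norm_sq_le (w : H20 Ω) : ‖w‖ ^ 2 ≤ 2 * (‖jet 0 w‖ ^ 2 + ‖jet 2 w‖ ^ 2) := by
  rw [norm_sq_eq]
  nlinarith [norm_jet_one_sq_le w, sq_nonneg (‖jet 0 w‖ - ‖jet 2 w‖), sq_nonneg ‖jet 0 w‖,
    sq_nonneg ‖jet 2 w‖]

/-- `φ(x)²` is the integral of `2 φ φ'` over `(-∞, x]`, and `|2 φ φ'| ≤ φ² + φ'²`. -/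
theorem abs_test_le_norm_testJet (φ : 𝓓(Ω, ℝ)) (x : ℝ) : |φ x| ≤ ‖testJet φ‖ := by
  have hd : ∀ y, HasDerivAt φ (deriv φ y) y := fun y => (test_differentiable φ y).hasDerivAt
  have h1 : ∫ y in Iic x, deriv (fun y => φ y * φ y) y = φ x * φ x :=
    HasCompactSupport.integral_Iic_deriv_eq
      ((φ.contDiff.mul φ.contDiff).of_le (by exact_mod_cast le_top))
      φ.hasCompactSupport.mul_right x
  have hi1 := integrable_test_mul φ φ
  have hi2 := integrable_test_mul (testDeriv φ) (testDeriv φ)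
  have hn : ∀ ψ : 𝓓(Ω, ℝ), ∫ y, ψ y * ψ y = ‖testLp ψ‖ ^ 2 := fun ψ => by
    rw [← setIntegral_mul_test, integral_mul_eq_inner (coeFn_testLp ψ) (coeFn_testLp ψ),
      real_inner_self_eq_norm_sq]
  have h2 : ‖∫ y in Iic x, deriv (fun y => φ y * φ y) y‖
      ≤ ∫ y in Iic x, (φ y * φ y + testDeriv φ y * testDeriv φ y) := by
    refine norm_integral_le_of_norm_le (hi1.add hi2).integrableOn (Eventually.of_forall fun y => ?_)
    have hy : deriv (fun y => φ y * φ y) y = deriv φ y * φ y + φ y * deriv φ y :=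
      ((hd y).mul (hd y)).deriv
    rw [hy, Real.norm_eq_abs, coe_testDeriv, abs_le]
    constructor <;> nlinarith [sq_nonneg (φ y - deriv φ y), sq_nonneg (φ y + deriv φ y)]
  have h3 : ∫ y in Iic x, (φ y * φ y + testDeriv φ y * testDeriv φ y)
      ≤ ∫ y, (φ y * φ y + testDeriv φ y * testDeriv φ y) :=
    setIntegral_le_integral (hi1.add hi2) (Eventually.of_forall fun y =>
      add_nonneg (mul_self_nonneg _) (mul_self_nonneg _))
  rw [integral_add hi1 hi2, hn, hn] at h3
  rw [h1, Real.norm_eq_abs, abs_mul_self] at h2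
  have h4 := norm_sq_jet (testJet φ)
  change _ = ‖testLp φ‖ ^ 2 + ‖testLp (testDeriv φ)‖ ^ 2 + _ at h4
  refine abs_le_of_sq_le_sq ?_ (norm_nonneg _)
  nlinarith [sq_nonneg ‖testJet φ 2‖]

/-- Approximating test functions converge a.e. along a subsequence, so their pointwise bound passes
to the limit. -/
theorem ae_abs_le_norm (w : H20 Ω) :
    ∀ᵐ x ∂volume.restrict (Ω : Set ℝ), |jet 0 w x| ≤ ‖w‖ := by
  obtain ⟨p, hp, hlim⟩ := mem_closure_iff_seq_limit.1 w.2
  choose φ hφ using fun n => exists_testJet_of_mem (hp n)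
  have h0 : Tendsto (fun n => testLp (φ n)) atTop (𝓝 (jet 0 w)) := by
    have := ((PiLp.proj (𝕜 := ℝ) 2 (fun _ : Fin 3 => L2 Ω) 0).continuous.tendsto _).comp hlim
    refine this.congr fun n => ?_
    simp only [Function.comp_apply, hφ n]
    rfl
  obtain ⟨ns, hns, hae⟩ := (tendstoInMeasure_of_tendsto_Lp h0).exists_seq_tendsto_ae
  have hae' := ae_all_iff.2 fun n => coeFn_testLp (φ n)
  filter_upwards [hae, hae'] with x hx hx'
  refine le_of_tendsto_of_tendsto hx.abs (hlim.norm.comp hns.tendsto_atTop)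
    (Eventually.of_forall fun n => ?_)
  simp only [Function.comp_apply, hφ (ns n), hx' (ns n)]
  exact abs_test_le_norm_testJet _ _

theorem ae_norm_mul_le (w : H20 Ω) (u : L2 Ω) :
    ∀ᵐ x ∂volume.restrict (Ω : Set ℝ), ‖jet 0 w x * u x‖ ≤ ‖w‖ * ‖u x‖ := by
  filter_upwards [ae_abs_le_norm w] with x hx
  rw [norm_mul]
  exact mul_le_mul_of_nonneg_right hx (norm_nonneg _)

theorem memLp_mul (w : H20 Ω) (u : L2 Ω) :
    MemLp (fun x => jet 0 w x * u x) 2 (volume.restrict (Ω : Set ℝ)) :=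
  (Lp.memLp u).of_le_mul ((Lp.aestronglyMeasurable _).mul (Lp.aestronglyMeasurable _))
    (ae_norm_mul_le w u)

variable (Ω) in
/-- Pointwise multiplication `H²₀(Ω) × L²(Ω) → L²(Ω)`. -/
def mulL : H20 Ω →L[ℝ] L2 Ω →L[ℝ] L2 Ω :=
  LinearMap.mkContinuous₂ (LinearMap.mk₂ ℝ (fun w u => (memLp_mul w u).toLp _)
    (fun w w' u => by
      rw [← MemLp.toLp_add]
      refine MemLp.toLp_congr _ _ ?_
      rw [map_add]
      filter_upwards [Lp.coeFn_add (jet 0 w) (jet 0 w')] with x hx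
      simp only [hx, Pi.add_apply, add_mul])
    (fun c w u => by
      rw [← MemLp.toLp_const_smul]
      refine MemLp.toLp_congr _ _ ?_
      rw [map_smul]
      filter_upwards [Lp.coeFn_smul c (jet 0 w)] with x hx
      simp only [hx, Pi.smul_apply, smul_mul_assoc])
    (fun w u u' => by
      rw [← MemLp.toLp_add]
      refine MemLp.toLp_congr _ _ ?_
      filter_upwards [Lp.coeFn_add u u'] with x hx
      simp only [hx, Pi.add_apply, mul_add])
    (fun c w u => by
      rw [← MemLp.toLp_const_smul]
      refine MemLp.toLp_congr _ _ ?_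
      filter_upwards [Lp.coeFn_smul c u] with x hx
      simp only [hx, Pi.smul_apply, mul_smul_comm])) 1
    (fun w u => by
      rw [one_mul]
      refine Lp.norm_le_mul_norm_of_ae_le_mul ?_
      filter_upwards [ae_norm_mul_le w u, (memLp_mul w u).coeFn_toLp] with x hx hx'
      rwa [LinearMap.mk₂_apply, hx'])

theorem coeFn_mulL (w : H20 Ω) (u : L2 Ω) :
    mulL Ω w u =ᵐ[volume.restrict (Ω : Set ℝ)] fun x => w.toL2 x * u x :=
  (memLp_mul w u).coeFn_toLp

variable (Ω) in
/-- The bilinear form `(w, z) ↦ ∫ w z + ∫ w'' z''` on `H²₀(Ω)`. -/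
def form : H20 Ω →L[ℝ] H20 Ω →L[ℝ] ℝ :=
  LinearMap.mkContinuous₂ (LinearMap.mk₂ ℝ
    (fun w z => inner ℝ (jet 0 w) (jet 0 z) + inner ℝ (jet 2 w) (jet 2 z))
    (fun w w' z => by simp only [map_add, inner_add_left]; ring)
    (fun c w z => by simp only [map_smul, real_inner_smul_left, smul_eq_mul]; ring)
    (fun w z z' => by simp only [map_add, inner_add_right]; ring)
    (fun c w z => by simp only [map_smul, real_inner_smul_right, smul_eq_mul]; ring)) 2
    (fun w z => by
      have h : ∀ k, ‖inner ℝ (jet k w) (jet k z)‖ ≤ ‖w‖ * ‖z‖ := fun k =>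
        (norm_inner_le_norm _ _).trans (mul_le_mul (norm_jet_le k w) (norm_jet_le k z)
          (norm_nonneg _) (norm_nonneg _))
      rw [LinearMap.mk₂_apply]
      refine (norm_add_le _ _).trans ?_
      linarith [h 0, h 2])

theorem form_apply (w z : H20 Ω) :
    form Ω w z = inner ℝ (jet 0 w) (jet 0 z) + inner ℝ (jet 2 w) (jet 2 z) := rfl

theorem isCoercive_form : IsCoercive (form Ω) := by
  refine ⟨1 / 2, by norm_num, fun w => ?_⟩
  rw [form_apply, real_inner_self_eq_norm_sq, real_inner_self_eq_norm_sq]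
  nlinarith [norm_sq_le w]

instance : CompleteSpace (H20 Ω) :=
  (Submodule.isClosed_topologicalClosure (testJets Ω)).completeSpace_coe

/-- Lax–Milgram with right-hand side `z ↦ ⟨f, z⟩`, represented in `H²₀(Ω)` by the adjoint of the
inclusion `jet 0`; testing with smooth functions suffices by density. -/
theorem exists_solution (Ω : TopologicalSpace.Opens ℝ) : ∃ G : L2 Ω →L[ℝ] H20 Ω,
    ∀ (f : L2 Ω) (w : H20 Ω), w = G f ↔
      ∀ φ : 𝓓(Ω, ℝ), form Ω w (ofTest φ) = inner ℝ f (testLp φ) := by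
  set e := (isCoercive_form (Ω := Ω)).continuousLinearEquivOfBilin
  refine ⟨(e.symm : H20 Ω →L[ℝ] H20 Ω).comp (jet 0 : H20 Ω →L[ℝ] L2 Ω).adjoint, fun f w => ?_⟩
  have h1 : w = ((e.symm : H20 Ω →L[ℝ] H20 Ω).comp (jet 0 : H20 Ω →L[ℝ] L2 Ω).adjoint) f ↔
      ∀ z, form Ω w z = inner ℝ f (jet 0 z) := by
    rw [ContinuousLinearMap.comp_apply, ContinuousLinearEquiv.coe_coe,
      ContinuousLinearEquiv.eq_symm_apply, ext_iff_inner_right ℝ]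
    refine forall_congr' fun z => ?_
    rw [IsCoercive.continuousLinearEquivOfBilin_apply, ContinuousLinearMap.adjoint_inner_left]
  rw [h1]
  refine ⟨fun h φ => h _, fun h z => ?_⟩
  refine closure_induction (P := fun p => inner ℝ (jet 0 w) (p 0) + inner ℝ (jet 2 w) (p 2)
    = inner ℝ f (p 0)) (isClosed_eq (by fun_prop) (by fun_prop)) (fun φ => h φ) z

end H20

end SobolevSpace

/-! ### Reduction of the system to a semilinear equation for `(u, v)`. -/

section Reaction

variable {Ω : TopologicalSpace.Opens ℝ}

/-- Two of the four derivatives on the test function move to `w`, turning the distributional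
equation into the variational one. -/
theorem algebraicEq_iff (U : StateX Ω) : AlgebraicEq U ↔
    ∀ φ : 𝓓(Ω, ℝ), H20.form Ω U.snd (H20.ofTest φ)
      = inner ℝ (-(U.fst.fst + U.fst.snd)) (testLp φ) := by
  refine forall_congr' fun φ => ?_
  rw [← coe_testDeriv_iterate, integral_mul_test_eq_inner]
  have h : ∫ x in (Ω : Set ℝ), (U.snd.toL2 x + U.fst.fst x + U.fst.snd x) * φ x
      = inner ℝ (U.snd.toL2 + U.fst.fst + U.fst.snd) (testLp φ) := by
    refine integral_mul_eq_inner ?_ (coeFn_testLp φ)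
    filter_upwards [Lp.coeFn_add (U.snd.toL2 + U.fst.fst) U.fst.snd,
      Lp.coeFn_add U.snd.toL2 U.fst.fst] with x h1 h2
    rw [h1, Pi.add_apply, h2, Pi.add_apply]
  rw [h, H20.form_apply]
  have h4 := H20.inner_jet_zero U.snd φ
  change inner ℝ U.snd.toL2 _ = _ at h4
  rw [h4, add_assoc, inner_add_left, inner_neg_left]
  change _ ↔ inner ℝ U.snd.toL2 (testLp φ) + inner ℝ (H20.jet 2 U.snd) (testLp (testDeriv^[2] φ))
    = _
  rw [eq_neg_iff_add_eq_zero]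
  ring_nf

theorem exists_algebraic_solution (Ω : TopologicalSpace.Opens ℝ) :
    ∃ P : StateE Ω →L[ℝ] H20 Ω, ∀ U : StateX Ω, AlgebraicEq U ↔ U.snd = P U.fst := by
  obtain ⟨G, hG⟩ := H20.exists_solution Ω
  refine ⟨G.comp (-(WithLp.fstL 2 ℝ (L2 Ω) (L2 Ω) + WithLp.sndL 2 ℝ (L2 Ω) (L2 Ω))), fun U => ?_⟩
  rw [algebraicEq_iff]
  exact (hG _ _).symm

/-- The reaction term as a function of `(u, v)`, where `w = P (u, v)`. -/
def reaction (P : StateE Ω →L[ℝ] H20 Ω) (V : StateE Ω) : StateE Ω :=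
  WithLp.toLp 2 (H20.mulL Ω (P V) (V.fst + V.snd), H20.mulL Ω (P V) V.snd + V.fst)

theorem isReaction_iff {P : StateE Ω →L[ℝ] H20 Ω} {U : StateX Ω} (hU : U.snd = P U.fst)
    (f : StateE Ω) : IsReaction U f ↔ f = reaction P U.fst := by
  have h1 : (reaction P U.fst).fst =ᵐ[volume.restrict (Ω : Set ℝ)] fun x =>
      U.snd.toL2 x * U.fst.snd x + U.fst.fst x * U.snd.toL2 x := by
    rw [hU]
    filter_upwards [H20.coeFn_mulL (P U.fst) (U.fst.fst + U.fst.snd),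
      Lp.coeFn_add U.fst.fst U.fst.snd] with x h1 h2
    refine h1.trans ?_
    rw [h2, Pi.add_apply]
    ring
  have h2 : (reaction P U.fst).snd =ᵐ[volume.restrict (Ω : Set ℝ)] fun x =>
      U.snd.toL2 x * U.fst.snd x + U.fst.fst x := by
    rw [hU]
    filter_upwards [H20.coeFn_mulL (P U.fst) U.fst.snd,
      Lp.coeFn_add (H20.mulL Ω (P U.fst) U.fst.snd) U.fst.fst] with x h1 h2
    refine h2.trans ?_
    rw [Pi.add_apply, h1]
  constructor
  · rintro ⟨h3, h4⟩
    exact WithLp.ofLp_injective 2 (Prod.ext (Lp.ext (h3.trans h1.symm)) (Lp.ext (h4.trans h2.symm)))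
  · rintro rfl
    exact ⟨h1, h2⟩

theorem lipschitzOnBalls_reaction (P : StateE Ω →L[ℝ] H20 Ω) : LipschitzOnBalls (reaction P) := by
  let p := WithLp.fstL 2 ℝ (L2 Ω) (L2 Ω)
  let q := WithLp.sndL 2 ℝ (L2 Ω) (L2 Ω)
  let e : L2 Ω × L2 Ω →L[ℝ] StateE Ω :=
    ((WithLp.prodContinuousLinearEquiv 2 ℝ (L2 Ω) (L2 Ω)).symm : _ →L[ℝ] _)
  have h1 := (lipschitzOnBalls_bilin (H20.mulL Ω) P (p + q)).clm_comp
    (e.comp (ContinuousLinearMap.inl ℝ _ _))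
  have h2 := ((lipschitzOnBalls_bilin (H20.mulL Ω) P q).add (lipschitzOnBalls_clm p)).clm_comp
    (e.comp (ContinuousLinearMap.inr ℝ _ _))
  have h : reaction P = fun V =>
      (e.comp (ContinuousLinearMap.inl ℝ _ _)) (H20.mulL Ω (P V) ((p + q) V)) +
      (e.comp (ContinuousLinearMap.inr ℝ _ _)) (H20.mulL Ω (P V) (q V) + p V) := by
    funext V
    refine WithLp.ofLp_injective 2 (Prod.ext ?_ ?_)
    · exact (add_zero _).symm
    · exact (zero_add _).symm
  rw [h]
  exact h1.add h2

/-- The semigroup inside `IsSolution` must agree with `T` at nonnegative times because the generator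
is the same and densely defined. Continuity of `w` is automatic, as `w = P V` with `P` bounded. -/
theorem isSolution_iff {b : BoundaryCondition} {T : ℝ → StateE Ω →L[ℝ] StateE Ω}
    (hT : IsContractionSemigroup T) (hTA : IsGenerator T (opA b)) {P : StateE Ω →L[ℝ] H20 Ω}
    (hP : ∀ U : StateX Ω, AlgebraicEq U ↔ U.snd = P U.fst) {V₀ : StateE Ω} {τ : EReal}
    {U : ℝ → StateX Ω} : IsSolution b V₀ τ U ↔
      IsMild T (reaction P) V₀ τ (fun t => (U t).fst) ∧
        ∀ t ∈ timeInterval τ, (U t).snd = P (U t).fst := by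
  constructor
  · rintro ⟨hc, halg, S, f, hS, hSA, hf, hU⟩
    have hw := fun t ht => (hP (U t)).1 (halg t ht)
    refine ⟨⟨(WithLp.fstL 2 ℝ (StateE Ω) (H20 Ω)).continuous.comp_continuousOn hc, fun t ht => ?_⟩,
      hw⟩
    have hST : ∀ s, 0 ≤ s → S s = T s := fun s hs =>
      hS.eq_of_isGenerator hT hSA hTA (isMDissipative_opA b).denseDomain hs
    simp only
    rw [(hU t ht).2, hST t ht.1]
    congr 1
    refine intervalIntegral.integral_congr fun s hs => ?_
    rw [uIcc_of_le ht.1] at hs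
    have hs' := Icc_subset_timeInterval ht hs
    rw [hST _ (sub_nonneg.2 hs.2), (isReaction_iff (hw s hs') _).1 (hf s hs')]
  · rintro ⟨⟨hc, hV⟩, hw⟩
    refine ⟨?_, fun t ht => (hP _).2 (hw t ht), T, fun t => reaction P (U t).fst, hT, hTA,
      fun t ht => (isReaction_iff (hw t ht) _).2 rfl, fun t ht => ⟨?_, hV t ht⟩⟩
    · have h := (WithLp.prodContinuousLinearEquiv 2 ℝ (StateE Ω) (H20 Ω)).symm.continuous
        |>.comp_continuousOn (hc.prodMk (P.continuous.comp_continuousOn hc))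
      refine h.congr fun t ht => WithLp.ofLp_injective 2 (Prod.ext rfl (hw t ht))
    · exact hT.intervalIntegrable ht.1 ((lipschitzOnBalls_reaction P).continuous.comp_continuousOn
        (hc.mono (Icc_subset_timeInterval ht)))

end Reaction

end

end PDAE

theorem mainTheorem2 (Ω : TopologicalSpace.Opens ℝ) (hΩ : Bornology.IsBounded (Ω : Set ℝ))
    (b : PDAE.BoundaryCondition) (V₀ : PDAE.StateE Ω) :
    ∃ tmax : EReal, 0 < tmax ∧ ∃ U : ℝ → PDAE.StateX Ω,
      PDAE.IsSolution b V₀ tmax U ∧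
      ∀ (τ : EReal) (U' : ℝ → PDAE.StateX Ω), PDAE.IsSolution b V₀ τ U' →
        τ ≤ tmax ∧ Set.EqOn U' U (PDAE.timeInterval τ) := by
  obtain ⟨T, hT, hTA⟩ := (PDAE.isMDissipative_opA (Ω := Ω) b).exists_semigroup
  obtain ⟨P, hP⟩ := PDAE.exists_algebraic_solution Ω
  obtain ⟨tmax, h0, V, hV, hmax⟩ :=
    PDAE.exists_isMild_maximal hT (PDAE.lipschitzOnBalls_reaction P) V₀
  refine ⟨tmax, h0, fun t => WithLp.toLp 2 (V t, P (V t)),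
    (PDAE.isSolution_iff hT hTA hP).2 ⟨hV, fun t _ => rfl⟩, fun τ U' hU' => ?_⟩
  obtain ⟨h1, h2⟩ := (PDAE.isSolution_iff hT hTA hP).1 hU'
  obtain ⟨hτ, he⟩ := hmax τ _ h1
  refine ⟨hτ, fun t ht => WithLp.ofLp_injective 2 (Prod.ext (he ht) ((h2 t ht).trans ?_))⟩
  exact congrArg P (he ht)
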